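/- Let $0<\rho<1$, let $\alpha,h\in\mathbb R$, and put $\eta=(1+\rho^2)\xi$, $z=-\rho^2\xi^2$ and $$\Delta_k^{\pm}=2k\pm\sqrt{\frac{h}{4(1+\rho^2)}}\qquad(k=0,1,2,\dots),$$ with an imaginary square root if $h<0$. Assume that $h\neq 4(1+\rho^2)m^2$ for every integer $m\ge 2$ (so that no denominator below vanishes). Let $(x)_i=x(x+1)\cdots(x+i-1)$ and consider $$ \begin{aligned} LF^R(\xi)=\;&\sum_{i_0=0}^{\infty}\frac{(\Delta_0^-)_{i_0}(\Delta_0^+)_{i_0}}{(1)_{i_0}(\frac12)_{i_0}}\eta^{i_0} +\sum_{n=1}^{\infty}\Bigg\{\sum_{i_0=0}^{\infty}\frac{(i_0+\frac{\alpha}{2}+\frac12)(i_0-\frac{\alpha}{2})}{(i_0+2)(i_0+\frac32)}\frac{(\Delta_0^-)_{i_0}(\Delta_0^+)_{i_0}}{(1)_{i_0}(\frac12)_{i_0}}\\ &\times\prod_{k=1}^{n-1}\Bigg\{\sum_{i_k=i_{k-1}}^{\infty}\frac{(i_k+2k+\frac{\alpha}{2}+\frac12)(i_k+2k-\frac{\alpha}{2})}{(i_k+2k+2)(i_k+2k+\frac32)}\frac{(\Delta_k^-)_{i_k}(\Delta_k^+)_{i_k}(2k+1)_{i_{k-1}}(2k+\frac12)_{i_{k-1}}}{(\Delta_k^-)_{i_{k-1}}(\Delta_k^+)_{i_{k-1}}(2k+1)_{i_k}(2k+\frac12)_{i_k}}\Bigg\}\\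 &\times\sum_{i_n=i_{n-1}}^{\infty}\frac{(\Delta_n^-)_{i_n}(\Delta_n^+)_{i_n}(2n+1)_{i_{n-1}}(2n+\frac12)_{i_{n-1}}}{(\Delta_n^-)_{i_{n-1}}(\Delta_n^+)_{i_{n-1}}(2n+1)_{i_n}(2n+\frac12)_{i_n}}\eta^{i_n}\Bigg\}z^n , \end{aligned} $$ where the products denote nested sums (each sum stands inside the preceding ones). Let $D=\{\xi\in\mathbb C:|\eta|+|z|<1\}$, a disc about $0$. Then: 1. For $\xi\in D$ all the nested series, and the series over $n$, converge absolutely. 2. $LF^R$ is the first (exponent $0$, normalized) local solution at $\xi=0$ of Lamé's equation $$\frac{d^2y}{d\xi^2}+\frac12\Big(\frac1\xi+\frac1{\xi-1}+\frac1{\xi-\rho^{-2}}\Big)\frac{dy}{d\xi}+\frac{-\alpha(\alpha+1)\xi+h\rho^{-2}}{4\xi(\xi-1)(\xi-\rho^{-2})}\,y=0 :$$ it is analytic on $D$, $LF^R(0)=1$, it satisfies the equation on $D\setminus\{0\}$, and every function that is analytic at $0$, takes the value $1$ there and satisfies the equation in a punctured neighbourhood of $0$ coincides with $LF^R$ near $0$.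 3. Let $K=\int_0^1\frac{dt}{\sqrt{(1-t^2)(1-\rho^2t^2)}}$. For real $u\in(-K,K)$ with $\mathrm{sn}^2(u,\rho)\in D$, the function $Y(u)=LF^R(\mathrm{sn}^2(u,\rho))$ is twice continuously differentiable near $u$ and satisfies Lamé's equation in Weierstrass's form, $Y''(u)=\{\alpha(\alpha+1)\rho^2\,\mathrm{sn}^2(u,\rho)-h\}\,Y(u)$. 4. If moreover $\alpha\notin\{2m,\,-(2m+1)\}$ for every integer $m\ge1$, then for $\xi\in D$ the series $LF^R(\xi)$ equals the three-term-recurrence (3TRF) series, in which the roles of the two terms of the recurrence are interchanged: $$ \begin{aligned} LF(\xi)=\;&\sum_{i_0=0}^{\infty}\frac{(-\frac\alpha4)_{i_0}(\frac\alpha4+\frac14)_{i_0}}{(1)_{i_0}(\frac34)_{i_0}}z^{i_0} +\sum_{n=1}^{\infty}\Bigg\{\sum_{i_0=0}^{\infty}\frac{i_0^2-\frac{h}{16(1+\rho^2)}}{(i_0+\frac12)(i_0+\frac14)}\frac{(-\frac\alpha4)_{i_0}(\frac\alpha4+\frac14)_{i_0}}{(1)_{i_0}(\frac34)_{i_0}}\\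 &\times\prod_{k=1}^{n-1}\Bigg\{\sum_{i_k=i_{k-1}}^{\infty}\frac{(i_k+\frac k2)^2-\frac{h}{16(1+\rho^2)}}{(i_k+\frac k2+\frac12)(i_k+\frac k2+\frac14)}\frac{(\frac k2-\frac\alpha4)_{i_k}(\frac k2+\frac\alpha4+\frac14)_{i_k}(\frac k2+1)_{i_{k-1}}(\frac k2+\frac34)_{i_{k-1}}}{(\frac k2-\frac\alpha4)_{i_{k-1}}(\frac k2+\frac\alpha4+\frac14)_{i_{k-1}}(\frac k2+1)_{i_k}(\frac k2+\frac34)_{i_k}}\Bigg\}\\ &\times\sum_{i_n=i_{n-1}}^{\infty}\frac{(\frac n2-\frac\alpha4)_{i_n}(\frac n2+\frac\alpha4+\frac14)_{i_n}(\frac n2+1)_{i_{n-1}}(\frac n2+\frac34)_{i_{n-1}}}{(\frac n2-\frac\alpha4)_{i_{n-1}}(\frac n2+\frac\alpha4+\frac14)_{i_{n-1}}(\frac n2+1)_{i_n}(\frac n2+\frac34)_{i_n}}z^{i_n}\Bigg\}\eta^n , \end{aligned} $$ all of whose series converge absolutely as well. -/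

import Mathlib

noncomputable section

namespace Lame

/-- The Pochhammer symbol `(x)_n = x (x+1) ⋯ (x+n-1)`. -/
def poch (x : ℂ) (n : ℕ) : ℂ := (ascPochhammer ℂ n).eval x

/-- For weights `w k p i`, factors `b k i` and a variable `t`, the summand with index `i = i_k`
of the nested series (with `p = i_{k-1}` and `m` further sums nested inside)
`∑_{i_k ≥ p} b k i_k * w k p i_k * ∑_{i_{k+1} ≥ i_k} b (k+1) i_{k+1} * w (k+1) i_k i_{k+1} * ⋯
  * ∑_{i_{k+m} ≥ i_{k+m-1}} w (k+m) i_{k+m-1} i_{k+m} * t ^ i_{k+m}`.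
The innermost sum has no factor `b` and carries the power of `t`. -/
def nestedSummand (w : ℕ → ℕ → ℕ → ℂ) (b : ℕ → ℕ → ℂ) (t : ℂ) : ℕ → ℕ → ℕ → ℕ → ℂ
  | 0, k, p, i => w k p i * t ^ i
  | m + 1, k, p, i => b k i * w k p i * ∑' j : ℕ, nestedSummand w b t m (k + 1) i (i + j)

/-- The nested series itself, summed over `i_k = p + j`, `j = 0, 1, 2, …`. -/
def nestedSum (w : ℕ → ℕ → ℕ → ℂ) (b : ℕ → ℕ → ℂ) (t : ℂ) (m k p : ℕ) : ℂ :=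
  ∑' j : ℕ, nestedSummand w b t m k p (p + j)

/-- All series occurring in `∑_n (nestedSum w b t n 0 0) * u ^ n` converge (in `ℂ`, summability is
absolute convergence): the nested ones at every level, and the outer series over `n`. -/
def NestedConverges (w : ℕ → ℕ → ℕ → ℂ) (b : ℕ → ℕ → ℂ) (t u : ℂ) : Prop :=
  (∀ m k p : ℕ, Summable fun j : ℕ => nestedSummand w b t m k p (p + j)) ∧
    Summable fun n : ℕ => nestedSum w b t n 0 0 * u ^ n

/-- `η = (1 + ρ²) ξ`. -/
def eta (ρ : ℝ) (ξ : ℂ) : ℂ := (1 + (ρ : ℂ) ^ 2) * ξ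

/-- `z = -ρ² ξ²`. -/
def zvar (ρ : ℝ) (ξ : ℂ) : ℂ := -(ρ : ℂ) ^ 2 * ξ ^ 2

/-- `√(h / (4 (1 + ρ²)))`, imaginary for `h < 0`. -/
def root (ρ h : ℝ) : ℂ := ((h / (4 * (1 + ρ ^ 2)) : ℝ) : ℂ) ^ (1 / 2 : ℂ)

def DeltaMinus (ρ h : ℝ) (k : ℕ) : ℂ := 2 * k - root ρ h

def DeltaPlus (ρ h : ℝ) (k : ℕ) : ℂ := 2 * k + root ρ h

/-- The Pochhammer quotient with index `i = i_k`, `p = i_{k-1}` of the R3TRF series. At `k = 0`,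
`p = 0` it is `(Δ₀⁻)_i (Δ₀⁺)_i / ((1)_i (1/2)_i)`. -/
def rWeight (ρ h : ℝ) (k p i : ℕ) : ℂ :=
  (poch (DeltaMinus ρ h k) i * poch (DeltaPlus ρ h k) i
      * poch (2 * k + 1) p * poch (2 * k + 1 / 2) p) /
    (poch (DeltaMinus ρ h k) p * poch (DeltaPlus ρ h k) p
      * poch (2 * k + 1) i * poch (2 * k + 1 / 2) i)

def rFactor (α : ℝ) (k i : ℕ) : ℂ :=
  ((i + 2 * k + α / 2 + 1 / 2) * (i + 2 * k - α / 2)) /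
    ((i + 2 * k + 2) * (i + 2 * k + 3 / 2))

/-- The R3TRF series of the first kind: a series in powers of `z` whose coefficients are nested
series in `η`. -/
def LFR (ρ α h : ℝ) (ξ : ℂ) : ℂ :=
  ∑' n : ℕ, nestedSum (rWeight ρ h) (rFactor α) (eta ρ ξ) n 0 0 * zvar ρ ξ ^ n

/-- The Pochhammer quotient of the 3TRF series. -/
def tWeight (α : ℝ) (k p i : ℕ) : ℂ :=
  (poch (k / 2 - α / 4) i * poch (k / 2 + α / 4 + 1 / 4) i
      * poch (k / 2 + 1) p * poch (k / 2 + 3 / 4) p) /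
    (poch (k / 2 - α / 4) p * poch (k / 2 + α / 4 + 1 / 4) p
      * poch (k / 2 + 1) i * poch (k / 2 + 3 / 4) i)

def tFactor (ρ h : ℝ) (k i : ℕ) : ℂ :=
  ((i + k / 2) ^ 2 - h / (16 * (1 + (ρ : ℂ) ^ 2))) /
    ((i + k / 2 + 1 / 2) * (i + k / 2 + 1 / 4))

/-- The 3TRF series of the first kind: a series in powers of `η` whose coefficients are nested
series in `z`. -/
def LF (ρ α h : ℝ) (ξ : ℂ) : ℂ :=
  ∑' n : ℕ, nestedSum (tWeight α) (tFactor ρ h) (zvar ρ ξ) n 0 0 * eta ρ ξ ^ n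

/-- The disc `|η| + |z| < 1` about `ξ = 0`. -/
def domain (ρ : ℝ) : Set ℂ := {ξ | ‖eta ρ ξ‖ + ‖zvar ρ ξ‖ < 1}

/-- Lamé's equation with independent variable `ξ = sn²(u, ρ)`, at the point `ξ`. -/
def LameEqAt (ρ α h : ℝ) (y : ℂ → ℂ) (ξ : ℂ) : Prop :=
  deriv (deriv y) ξ
    + 1 / 2 * (1 / ξ + 1 / (ξ - 1) + 1 / (ξ - ((ρ : ℂ) ^ 2)⁻¹)) * deriv y ξ
    + (-(α * (α + 1)) * ξ + h * ((ρ : ℂ) ^ 2)⁻¹) /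
        (4 * ξ * (ξ - 1) * (ξ - ((ρ : ℂ) ^ 2)⁻¹)) * y ξ = 0

/-- The incomplete elliptic integral of the first kind, in Jacobi's form. -/
def ellipticF (ρ x : ℝ) : ℝ := ∫ t in (0 : ℝ)..x, 1 / √((1 - t ^ 2) * (1 - ρ ^ 2 * t ^ 2))

/-- The interval `(-K, K)`, with `K` the complete elliptic integral. -/
def snDomain (ρ : ℝ) : Set ℝ := ellipticF ρ '' Set.Ioo (-1) 1

/-- Jacobi's `sn(u, ρ)` for `-K < u < K`: the inverse of the elliptic integral on `(-1, 1)`. -/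
def sn (ρ u : ℝ) : ℝ := Function.invFunOn (ellipticF ρ) (Set.Ioo (-1) 1) u

end Lame

end

noncomputable section

namespace Lame

open Finset Filter Topology


/-! Both expansions are groupings of one absolutely convergent double series in `η` and `z`. Its
coefficient at `η ^ l * z ^ m` is a sum over lattice paths from `(0, 0)` to `(m, l)`: from a point
of position `n = l + 2m` (the power of `ξ`) an `η`-step carries the weight `stepEta n` and a
`z`-step `stepZ n`. In a nested sum the Pochhammer quotients are the products of weights along a
row, and the factors between them are the steps to the next row. Interchanging the two kinds of step
transposes the paths (`pathCoeff_swap`), so R3TRF and 3TRF have the same coefficients.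

Convergence: both step weights tend to `1`, so a product of them along a path is at most `C * R ^ (m
+ l)` for any `R > 1`. There are `(m + l).choose m` paths, so the terms of total degree `n` sum to
at most a constant times `(R * (‖η‖ + ‖z‖)) ^ n`, which is geometric on `D` once `R` is close to
`1`.

The equation: splitting paths by their last step and collecting powers of `ξ` gives the three-term
Frobenius recurrence (`lameSeries_add_two`). This is the vanishing of the coefficients of the
cleared Lamé operator (`opCoeff_succ_eq`), and it also determines an analytic solution from its
value at `0`. Weierstrass's form follows by the chain rule from `sn'² = (1 - sn²)(1 - ρ² sn²)`. -/

/-- The coefficient of `t ^ (p + l)` in `nestedSum w b t m k p`. -/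
def nestedCoeff (w : ℕ → ℕ → ℕ → ℂ) (b : ℕ → ℕ → ℂ) : ℕ → ℕ → ℕ → ℕ → ℂ
  | 0, k, p, l => w k p (p + l)
  | m + 1, k, p, l => ∑ x ∈ antidiagonal l,
      b k (p + x.1) * w k p (p + x.1) * nestedCoeff w b m (k + 1) (p + x.1) x.2

/-- A potential `Q` that dominates the growth of products of weights and factors along lattice
paths. -/
structure Majorant (w : ℕ → ℕ → ℕ → ℂ) (b : ℕ → ℕ → ℂ) (Q : ℕ → ℕ → ℝ) : Prop where
  pos : ∀ k i, 0 < Q k i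
  weight : ∀ k p j, ‖w k p (p + j)‖ * Q k p ≤ Q k (p + j)
  factor : ∀ k i, ‖b k i‖ * Q k i ≤ Q (k + 1) i

/-! ### Nested series as sums over lattice paths. -/

section Nested

variable {w : ℕ → ℕ → ℕ → ℂ} {b : ℕ → ℕ → ℂ} {Q : ℕ → ℕ → ℝ}

/-- Hockey-stick identity: paths counted by the place where they leave their first row. -/
lemma sum_antidiagonal_choose (m l : ℕ) :
    ∑ x ∈ antidiagonal l, ((m + x.2).choose m : ℝ) = ((m + 1 + l).choose (m + 1) : ℝ) := by
  rw [Nat.sum_antidiagonal_eq_sum_range_succ (fun _ j => ((m + j).choose m : ℝ)),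
    ← Finset.sum_range_reflect]
  have := Nat.sum_range_add_choose l m
  rw [show m + 1 + l = l + m + 1 by ring, ← this]
  push_cast
  refine Finset.sum_congr rfl fun j hj => ?_
  have hj' : j < l + 1 := Finset.mem_range.1 hj
  rw [show m + (l - (l - j)) = j + m by omega]

/-- The potential telescopes along a path, from `Q k p` through `Q k (p + x.1)` to `Q (k + 1) (p +
x.1)`, so only the number of paths remains. The norms stay inside the sum because
`hasSum_nestedCoeff` needs absolute summability of the whole family. -/
lemma Majorant.sum_norm_le_of_norm_le (hQ : Majorant w b Q) {m k : ℕ}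
    (ih : ∀ p l, ‖nestedCoeff w b m (k + 1) p l‖ * Q (k + 1) p ≤
      (m + l).choose m * Q (k + 1 + m) (p + l)) (p l : ℕ) :
    (∑ x ∈ antidiagonal l, ‖b k (p + x.1) * w k p (p + x.1)‖ *
      ‖nestedCoeff w b m (k + 1) (p + x.1) x.2‖) * Q k p ≤
      (m + 1 + l).choose (m + 1) * Q (k + (m + 1)) (p + l) := by
  rw [← sum_antidiagonal_choose, Finset.sum_mul, Finset.sum_mul]
  refine Finset.sum_le_sum fun x hx => ?_
  have hx' : x.1 + x.2 = l := mem_antidiagonal.1 hx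
  set c := ‖nestedCoeff w b m (k + 1) (p + x.1) x.2‖
  have hc : 0 ≤ c := norm_nonneg _
  rw [norm_mul]
  calc ‖b k (p + x.1)‖ * ‖w k p (p + x.1)‖ * c * Q k p
      = ‖b k (p + x.1)‖ * (‖w k p (p + x.1)‖ * Q k p) * c := by ring
    _ ≤ ‖b k (p + x.1)‖ * Q k (p + x.1) * c := by
      gcongr; exact hQ.weight k p x.1
    _ ≤ Q (k + 1) (p + x.1) * c := by
      gcongr; exact hQ.factor k _
    _ = c * Q (k + 1) (p + x.1) := mul_comm _ _
    _ ≤ (m + x.2).choose m * Q (k + 1 + m) (p + x.1 + x.2) := ih _ _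
    _ = (m + x.2).choose m * Q (k + (m + 1)) (p + l) := by
      rw [← hx', show k + 1 + m = k + (m + 1) by ring, add_assoc]

lemma Majorant.norm_nestedCoeff_le (hQ : Majorant w b Q) (m k p l : ℕ) :
    ‖nestedCoeff w b m k p l‖ * Q k p ≤ (m + l).choose m * Q (k + m) (p + l) := by
  induction m generalizing k p l with
  | zero => simpa [nestedCoeff] using hQ.weight k p l
  | succ m ih =>
    refine le_trans ?_ (hQ.sum_norm_le_of_norm_le (ih (k + 1)) p l)
    gcongr
    · exact (hQ.pos k p).le
    · rw [nestedCoeff]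
      exact (norm_sum_le _ _).trans (Finset.sum_le_sum fun x _ => (norm_mul _ _).le)

lemma choose_mul_pow_le {x y : ℝ} (hx : 0 ≤ x) (hy : 0 ≤ y) (m l : ℕ) :
    ((m + l).choose m : ℝ) * x ^ l * y ^ m ≤ (x + y) ^ (m + l) := by
  rw [add_comm x y, add_pow]
  have := Finset.single_le_sum (s := range (m + l + 1))
    (f := fun j => y ^ j * x ^ (m + l - j) * ((m + l).choose j : ℝ))
    (fun j _ => by positivity) (Finset.mem_range.2 (show m < m + l + 1 by omega))
  refine le_trans (le_of_eq ?_) this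
  simp only [Nat.add_sub_cancel_left]
  ring

/-- Geometric growth of a potential. -/
def GrowsAtMost (Q : ℕ → ℕ → ℝ) (R : ℝ) : Prop :=
  ∃ C : ℝ, ∀ k i, Q k i ≤ C * R ^ (k + i)

/-- `U` stands in for the norm of the outer variable. It must be positive, since one term of the
binomial expansion of `(T + U) ^ (m + l)` is divided by `U ^ m`. -/
lemma summable_choose_mul {R T U : ℝ} (hpos : ∀ k i, 0 < Q k i) (hgrow : GrowsAtMost Q R)
    (hR : 0 < R) (hT : 0 ≤ T) (hU : 0 < U) (hRTU : R * (T + U) < 1) (m k p : ℕ) :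
    Summable fun l : ℕ => ((m + l).choose m : ℝ) * Q (k + m) (p + l) * T ^ (p + l) := by
  obtain ⟨C, hC⟩ := hgrow
  have hC0 : 0 ≤ C := by
    have h1 := hC 0 0
    simp only [add_zero, pow_zero, mul_one] at h1
    exact (hpos 0 0).le.trans h1
  have hgeo := (summable_geometric_of_lt_one (by positivity : 0 ≤ R * (T + U)) hRTU).mul_left
    (C * R ^ (k + m + p) * T ^ p * (T + U) ^ m / U ^ m)
  refine Summable.of_nonneg_of_le (fun l => ?_) (fun l => ?_) hgeo
  · have := (hpos (k + m) (p + l)).le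
    positivity
  · have h1 := choose_mul_pow_le hT hU.le m l
    have h2 : ((m + l).choose m : ℝ) * T ^ l ≤ (T + U) ^ (m + l) / U ^ m := by
      rwa [le_div_iff₀ (by positivity)]
    calc ((m + l).choose m : ℝ) * Q (k + m) (p + l) * T ^ (p + l)
        = Q (k + m) (p + l) * T ^ p * (((m + l).choose m : ℝ) * T ^ l) := by ring
      _ ≤ (C * R ^ (k + m + (p + l))) * T ^ p * ((T + U) ^ (m + l) / U ^ m) := by
          gcongr
          exact hC _ _
      _ = _ := by
          rw [mul_pow]; ring

lemma summable_of_sum_antidiagonal {g : ℕ × ℕ → ℝ} (hg : ∀ x, 0 ≤ g x)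
    (h : Summable fun n => ∑ x ∈ antidiagonal n, g x) : Summable g := by
  refine (Finset.HasAntidiagonal.sigmaAntidiagonalEquivProd (A := ℕ)).summable_iff.1
    ((summable_sigma_of_nonneg fun x => hg _).2 ⟨fun n => (hasSum_fintype _).summable, ?_⟩)
  refine h.congr fun n => ?_
  rw [tsum_fintype]
  exact (Finset.sum_coe_sort (antidiagonal n) g).symm

lemma hasSum_sum_antidiagonal {g : ℕ × ℕ → ℂ} {a : ℂ} (h : HasSum g a) :
    HasSum (fun n => ∑ x ∈ antidiagonal n, g x) a := by
  have h1 := ((Finset.HasAntidiagonal.sigmaAntidiagonalEquivProd (A := ℕ)).hasSum_iff.2 h).sigma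
    fun n => hasSum_fintype _
  convert! h1 using 2 with n
  exact (Finset.sum_coe_sort (antidiagonal n) g).symm

/-- By induction on the depth: the family indexed by (advance in the first row, advance in the
remaining rows) is absolutely summable. Summed over fibres it is the nested series; summed over
antidiagonals it is the power series in `t`. -/
theorem Majorant.hasSum_nestedCoeff (hQ : Majorant w b Q) {R U : ℝ} (hgrow : GrowsAtMost Q R)
    (hR : 0 < R) (hU : 0 < U) {t : ℂ} (ht : R * (‖t‖ + U) < 1) (m k p : ℕ) :
    (Summable fun j : ℕ => nestedSummand w b t m k p (p + j)) ∧
    HasSum (fun l : ℕ => nestedCoeff w b m k p l * t ^ (p + l)) (nestedSum w b t m k p) := by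
  have hsum : ∀ m k p, Summable fun l : ℕ =>
      ((m + l).choose m : ℝ) * Q (k + m) (p + l) * ‖t‖ ^ (p + l) :=
    summable_choose_mul hQ.pos hgrow hR (norm_nonneg t) hU ht
  induction m generalizing k p with
  | zero =>
    have : Summable fun j : ℕ => nestedSummand w b t 0 k p (p + j) := by
      refine Summable.of_norm_bounded ((hsum 0 k p).div_const (Q k p)) fun l => ?_
      rw [le_div_iff₀ (hQ.pos k p)]
      have := hQ.weight k p l
      simp only [nestedSummand, norm_mul, norm_pow, Nat.choose_zero_right, Nat.cast_one, one_mul,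
        add_zero]
      calc _ = ‖w k p (p + l)‖ * Q k p * ‖t‖ ^ (p + l) := by ring
        _ ≤ _ := by gcongr
    exact ⟨this, this.hasSum⟩
  | succ m ih =>
    let g : ℕ × ℕ → ℂ := fun x => b k (p + x.1) * w k p (p + x.1) *
      (nestedCoeff w b m (k + 1) (p + x.1) x.2 * t ^ (p + x.1 + x.2))
    have hg : Summable g := by
      refine Summable.of_norm (summable_of_sum_antidiagonal (fun _ => norm_nonneg _) ?_)
      refine Summable.of_nonneg_of_le (fun l => Finset.sum_nonneg fun _ _ => norm_nonneg _)
        (fun l => ?_) ((hsum (m + 1) k p).div_const (Q k p))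
      rw [le_div_iff₀ (hQ.pos k p)]
      have := hQ.sum_norm_le_of_norm_le (hQ.norm_nestedCoeff_le m (k + 1)) p l
      refine le_trans (le_of_eq ?_) (mul_le_mul_of_nonneg_right this
        (pow_nonneg (norm_nonneg t) (p + l)))
      rw [mul_right_comm, Finset.sum_mul (antidiagonal l) _ (‖t‖ ^ (p + l))]
      congr 1
      refine Finset.sum_congr rfl fun x hx => ?_
      have hx' : x.1 + x.2 = l := mem_antidiagonal.1 hx
      simp only [g, norm_mul, norm_pow, add_assoc, hx']
      ring
    have h1 : HasSum (fun j => nestedSummand w b t (m + 1) k p (p + j)) (∑' x, g x) := by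
      refine HasSum.prod_fiberwise hg.hasSum fun j => ?_
      exact (ih (k + 1) (p + j)).2.mul_left (b k (p + j) * w k p (p + j))
    refine ⟨h1.summable, ?_⟩
    rw [nestedSum, h1.tsum_eq]
    have h2 := hasSum_sum_antidiagonal hg.hasSum
    convert! h2 using 2 with l
    rw [nestedCoeff, Finset.sum_mul]
    refine Finset.sum_congr rfl fun x hx => ?_
    have hx' : x.1 + x.2 = l := mem_antidiagonal.1 hx
    simp only [g, add_assoc, hx']
    ring

/-- The sum over all lattice paths from `(0, 0)` to `(m, l)` of the products of step weights. -/
def pathCoeff (f b : ℕ → ℕ → ℂ) : ℕ → ℕ → ℂ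
  | 0, 0 => 1
  | 0, l + 1 => f 0 l * pathCoeff f b 0 l
  | m + 1, 0 => b m 0 * pathCoeff f b m 0
  | m + 1, l + 1 => f (m + 1) l * pathCoeff f b (m + 1) l + b m (l + 1) * pathCoeff f b m (l + 1)

lemma pathCoeff_swap (f b : ℕ → ℕ → ℂ) (m l : ℕ) :
    pathCoeff (fun k i => b i k) (fun k i => f i k) l m = pathCoeff f b m l := by
  induction m generalizing l with
  | zero =>
    induction l with
    | zero => simp [pathCoeff]
    | succ l ih => simp [pathCoeff, ih]
  | succ m ihm =>
    induction l with
    | zero => simp [pathCoeff, ihm]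
    | succ l ihl => simp only [pathCoeff, ihm, ihl]; ring

/-- The weights `w` are the products of the step weights `f`. -/
structure IsPathWeight (w : ℕ → ℕ → ℕ → ℂ) (f : ℕ → ℕ → ℂ) : Prop where
  succ : ∀ k p j, w k p (p + j + 1) = f k (p + j) * w k p (p + j)
  self : ∀ k p, w (k + 1) p p = 1
  zero : w 0 0 0 = 1

variable {f : ℕ → ℕ → ℂ}

lemma IsPathWeight.nestedCoeff_succ_zero (hw : IsPathWeight w f) (m k p : ℕ) :
    nestedCoeff w b (m + 1) k p 0 = b (k + m) p * nestedCoeff w b m k p 0 := by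
  induction m generalizing k with
  | zero => simp [nestedCoeff, hw.self]
  | succ m ih =>
    have h := ih (k + 1)
    rw [nestedCoeff.eq_2 w b k p 0 (m + 1), nestedCoeff.eq_2 w b k p 0 m]
    simp only [Finset.Nat.antidiagonal_zero, sum_singleton, add_zero, h]
    rw [show k + 1 + m = k + (m + 1) by ring]
    ring

/-- `nestedCoeff` recurses on the first row, `pathCoeff` on the last step. Induction on the number
of rows, with the starting row `k` free, carries the last-step rule through the first-row recursion.
-/
lemma IsPathWeight.nestedCoeff_succ_succ (hw : IsPathWeight w f) (m k p l : ℕ) :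
    nestedCoeff w b (m + 1) k p (l + 1) = f (k + m + 1) (p + l) * nestedCoeff w b (m + 1) k p l +
      b (k + m) (p + l + 1) * nestedCoeff w b m k p (l + 1) := by
  induction m generalizing k p l with
  | zero =>
    simp only [nestedCoeff, Nat.sum_antidiagonal_succ', add_zero, hw.self, mul_one,
      ← add_assoc, hw.succ]
    rw [add_comm, Finset.mul_sum]
    refine congrArg₂ _ (Finset.sum_congr rfl fun x hx => ?_) rfl
    have hx' : x.1 + x.2 = l := mem_antidiagonal.1 hx
    rw [show p + x.1 + x.2 = p + l by omega]
    ring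
  | succ m ih =>
    have hstep := ih (k + 1)
    rw [nestedCoeff.eq_2 w b k p _ (m + 1), nestedCoeff.eq_2 w b k p _ (m + 1),
      nestedCoeff.eq_2 w b k p _ m, Nat.sum_antidiagonal_succ', Nat.sum_antidiagonal_succ']
    have e1 : ∑ x ∈ antidiagonal l, b k (p + x.1) * w k p (p + x.1) *
          nestedCoeff w b (m + 1) (k + 1) (p + x.1) (x.2 + 1) =
        f (k + (m + 1) + 1) (p + l) * (∑ x ∈ antidiagonal l, b k (p + x.1) * w k p (p + x.1) *
          nestedCoeff w b (m + 1) (k + 1) (p + x.1) x.2) +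
        b (k + (m + 1)) (p + l + 1) * (∑ x ∈ antidiagonal l, b k (p + x.1) * w k p (p + x.1) *
          nestedCoeff w b m (k + 1) (p + x.1) (x.2 + 1)) := by
      rw [Finset.mul_sum, Finset.mul_sum, ← Finset.sum_add_distrib]
      refine Finset.sum_congr rfl fun x hx => ?_
      have hx' : x.1 + x.2 = l := mem_antidiagonal.1 hx
      rw [hstep, show p + x.1 + x.2 = p + l by omega, show k + 1 + m = k + (m + 1) by ring]
      ring
    simp only [e1, hw.nestedCoeff_succ_zero]
    rw [show k + 1 + m = k + (m + 1) by ring, ← add_assoc p l 1]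
    ring

lemma IsPathWeight.nestedCoeff_eq (hw : IsPathWeight w f) (m l : ℕ) :
    nestedCoeff w b m 0 0 l = pathCoeff f b m l := by
  induction m generalizing l with
  | zero =>
    induction l with
    | zero => simp [pathCoeff, nestedCoeff, hw.zero]
    | succ l ih =>
      simp only [pathCoeff, ← ih]
      simpa [nestedCoeff] using hw.succ 0 0 l
  | succ m ihm =>
    induction l with
    | zero => rw [hw.nestedCoeff_succ_zero, ihm, pathCoeff, zero_add]
    | succ l ihl => simp only [hw.nestedCoeff_succ_succ, ihm, ihl, pathCoeff, zero_add]

lemma Majorant.norm_pathCoeff_le (hQ : Majorant w b Q) (hw : IsPathWeight w f) (m l : ℕ) :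
    ‖pathCoeff f b m l‖ * Q 0 0 ≤ (m + l).choose m * Q m l := by
  simpa [hw.nestedCoeff_eq] using hQ.norm_nestedCoeff_le m 0 0 l

/-- The double series with path coefficients converges absolutely. -/
theorem Majorant.summable_pathCoeff (hQ : Majorant w b Q) (hw : IsPathWeight w f) {R : ℝ}
    (hgrow : GrowsAtMost Q R) (hR : 0 < R) {t u : ℂ} (htu : R * (‖t‖ + ‖u‖) < 1) :
    Summable fun x : ℕ × ℕ => pathCoeff f b x.1 x.2 * t ^ x.2 * u ^ x.1 := by
  obtain ⟨C, hC⟩ := hgrow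
  refine Summable.of_norm (summable_of_sum_antidiagonal (fun _ => norm_nonneg _) ?_)
  have hgeo := (summable_geometric_of_lt_one (by positivity : 0 ≤ R * (‖t‖ + ‖u‖)) htu).mul_left
    (C / Q 0 0)
  refine Summable.of_nonneg_of_le (fun l => Finset.sum_nonneg fun _ _ => norm_nonneg _)
    (fun n => ?_) hgeo
  rw [mul_pow, add_comm ‖t‖, (Commute.all ‖u‖ ‖t‖).add_pow', Finset.mul_sum, Finset.mul_sum]
  refine Finset.sum_le_sum fun x hx => ?_
  have hx' : x.1 + x.2 = n := mem_antidiagonal.1 hx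
  have h0 := hQ.pos 0 0
  have h1 : ‖pathCoeff f b x.1 x.2‖ ≤ n.choose x.1 * (C * R ^ n) / Q 0 0 := by
    rw [le_div_iff₀ h0, ← hx']
    refine (hQ.norm_pathCoeff_le hw _ _).trans ?_
    gcongr
    exact hC _ _
  rw [norm_mul, norm_mul, norm_pow, norm_pow, nsmul_eq_mul]
  calc _ ≤ n.choose x.1 * (C * R ^ n) / Q 0 0 * ‖t‖ ^ x.2 * ‖u‖ ^ x.1 := by gcongr
    _ = _ := by ring

lemma exists_between_norms {R x y : ℝ} (hR : 0 < R) (h : R * (x + y) < 1) :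
    ∃ U, y < U ∧ R * (x + U) < 1 := by
  refine ⟨y + (1 - R * (x + y)) / (2 * R), ?_, ?_⟩
  · have : 0 < (1 - R * (x + y)) / (2 * R) := div_pos (by linarith) (by linarith)
    linarith
  · have : R * (x + (y + (1 - R * (x + y)) / (2 * R))) = (1 + R * (x + y)) / 2 := by
      field_simp; ring
    linarith

theorem Majorant.nestedSum_eq (hQ : Majorant w b Q) (hw : IsPathWeight w f) {R : ℝ}
    (hgrow : GrowsAtMost Q R) (hR : 0 < R) {t u : ℂ} (htu : R * (‖t‖ + ‖u‖) < 1) :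
    NestedConverges w b t u ∧
      HasSum (fun m => nestedSum w b t m 0 0 * u ^ m)
        (∑' x : ℕ × ℕ, pathCoeff f b x.1 x.2 * t ^ x.2 * u ^ x.1) := by
  obtain ⟨U, hU, hRU⟩ := exists_between_norms hR htu
  have hU0 : 0 < U := (norm_nonneg u).trans_lt hU
  have h := hQ.hasSum_nestedCoeff hgrow hR hU0 hRU
  have hs : HasSum (fun m => nestedSum w b t m 0 0 * u ^ m)
      (∑' x : ℕ × ℕ, pathCoeff f b x.1 x.2 * t ^ x.2 * u ^ x.1) := by
    refine HasSum.prod_fiberwise (hQ.summable_pathCoeff hw hgrow hR htu).hasSum fun m => ?_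
    have h1 := (h m 0 0).2.mul_right (u ^ m)
    simpa only [hw.nestedCoeff_eq, zero_add] using h1
  exact ⟨⟨fun m k p => (h m k p).1, hs.summable⟩, hs⟩

end Nested


/-! ### Majorants and step weights for Lamé's equation. -/

/-- Asking only `‖w k p p‖ ≤ 1` keeps this valid when a Pochhammer denominator vanishes, as then `0
/ 0 = 0`. -/
lemma Majorant.of_step {w : ℕ → ℕ → ℕ → ℂ} {f b : ℕ → ℕ → ℂ} {Q : ℕ → ℕ → ℝ}
    (pos : ∀ k i, 0 < Q k i) (self : ∀ k p, ‖w k p p‖ ≤ 1)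
    (succ : ∀ k p j, w k p (p + j + 1) = f k (p + j) * w k p (p + j))
    (step : ∀ k i, ‖f k i‖ * Q k i ≤ Q k (i + 1)) (factor : ∀ k i, ‖b k i‖ * Q k i ≤ Q (k + 1) i) :
    Majorant w b Q where
  pos := pos
  factor := factor
  weight k p j := by
    induction j with
    | zero => simpa using mul_le_mul_of_nonneg_right (self k p) (pos k p).le
    | succ j ih =>
      rw [← add_assoc, succ, norm_mul, mul_assoc]
      exact (mul_le_mul_of_nonneg_left ih (norm_nonneg _)).trans (step k _)

lemma exists_product_bound {θ : ℕ → ℝ} (hθ : ∀ n, 1 ≤ θ n) (hlim : Tendsto θ atTop (𝓝 1))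
    {r : ℝ} (hr : 1 < r) : ∃ C, ∀ n, ∏ j ∈ range n, θ j ≤ C * r ^ n := by
  obtain ⟨N, hN⟩ := eventually_atTop.1 (hlim.eventually_le_const hr)
  have hP : ∀ n, 0 < ∏ j ∈ range n, θ j := fun n => prod_pos fun j _ => by linarith [hθ j]
  have hmono : Monotone fun n => ∏ j ∈ range n, θ j := monotone_nat_of_le_succ fun n => by
    rw [prod_range_succ]
    exact le_mul_of_one_le_right (hP n).le (hθ n)
  refine ⟨∏ j ∈ range N, θ j, fun n => ?_⟩
  induction n with
  | zero => simpa using hmono (Nat.zero_le N)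
  | succ n ih =>
    rcases le_or_gt N n with h | h
    · rw [prod_range_succ, pow_succ, ← mul_assoc]
      have h0 := (hP N).le
      exact mul_le_mul ih (hN n h) (by linarith [hθ n]) (by positivity)
    · exact (hmono h).trans (le_mul_of_one_le_right (hP N).le (one_le_pow₀ hr.le))

lemma tendsto_natCast_add_div_add (a b : ℂ) :
    Tendsto (fun n : ℕ => ((n : ℂ) + a) / (n + b)) atTop (𝓝 1) := by
  have h := (tendsto_natCast_div_add_atTop b).div (tendsto_natCast_div_add_atTop a) one_ne_zero
  rw [div_one] at h
  refine h.congr' ?_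
  filter_upwards [eventually_ne_atTop 0] with n hn
  have hn' : (n : ℂ) ≠ 0 := Nat.cast_ne_zero.2 hn
  simp only [Pi.div_apply]
  rw [div_div_div_eq, mul_comm (n : ℂ) (n + a), mul_div_mul_right _ _ hn']

/-- The coefficient of `η` in the recurrence, for a step leaving the position `n`. -/
def stepEta (ρ h : ℝ) (n : ℕ) : ℂ :=
  ((n - root ρ h) * (n + root ρ h)) / ((n + 1) * (n + 1 / 2))

/-- The coefficient of `z` in the recurrence, for a step leaving the position `n`. -/
def stepZ (α : ℝ) (n : ℕ) : ℂ := ((n + α / 2 + 1 / 2) * (n - α / 2)) / ((n + 2) * (n + 3 / 2))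

lemma tendsto_stepEta (ρ h : ℝ) : Tendsto (stepEta ρ h) atTop (𝓝 1) := by
  have := (tendsto_natCast_add_div_add (-root ρ h) 1).mul
    (tendsto_natCast_add_div_add (root ρ h) (1 / 2))
  rw [mul_one] at this
  refine this.congr fun n => ?_
  rw [stepEta, div_mul_div_comm, sub_eq_add_neg]

lemma tendsto_stepZ (α : ℝ) : Tendsto (stepZ α) atTop (𝓝 1) := by
  have := (tendsto_natCast_add_div_add (α / 2 + 1 / 2) 2).mul
    (tendsto_natCast_add_div_add (-(α / 2)) (3 / 2))
  rw [mul_one] at this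
  refine this.congr fun n => ?_
  rw [stepZ, div_mul_div_comm, sub_eq_add_neg, add_assoc]

/-- `P n` is the product over `j < n` of `max 1 (max ‖stepEta ρ h j‖ ‖stepZ α j‖)`. The entry `1`
makes `P` monotone, and the limit `1` of the factors makes its growth slower than any `r ^ n`. -/
lemma exists_potential (ρ α h : ℝ) {r : ℝ} (hr : 1 < r) :
    ∃ P : ℕ → ℝ, (∀ n, 0 < P n) ∧ Monotone P ∧ (∀ n, ‖stepEta ρ h n‖ * P n ≤ P (n + 1)) ∧
      (∀ n, ‖stepZ α n‖ * P n ≤ P (n + 1)) ∧ ∃ C, 0 ≤ C ∧ ∀ n, P n ≤ C * r ^ n := by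
  let θ : ℕ → ℝ := fun n => max 1 (max ‖stepEta ρ h n‖ ‖stepZ α n‖)
  have h1 : ∀ n, 1 ≤ θ n := fun n => le_max_left _ _
  have hlim : Tendsto θ atTop (𝓝 1) := by
    have := (tendsto_const_nhds (x := (1 : ℝ)) (f := atTop)).max
      ((tendsto_stepEta ρ h).norm.max (tendsto_stepZ α).norm)
    simpa using this
  have hP : ∀ n, 0 < ∏ j ∈ range n, θ j := fun n => prod_pos fun j _ => by linarith [h1 j]
  obtain ⟨C, hC⟩ := exists_product_bound h1 hlim hr
  refine ⟨fun n => ∏ j ∈ range n, θ j, hP, monotone_nat_of_le_succ fun n => ?_, fun n => ?_,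
    fun n => ?_, C, ?_, hC⟩
  · simp only [prod_range_succ]
    exact le_mul_of_one_le_right (hP n).le (h1 n)
  · simp only [prod_range_succ]
    rw [mul_comm]
    exact mul_le_mul_of_nonneg_left ((le_max_left _ _).trans (le_max_right _ _)) (hP n).le
  · simp only [prod_range_succ]
    rw [mul_comm]
    exact mul_le_mul_of_nonneg_left ((le_max_right _ _).trans (le_max_right _ _)) (hP n).le
  · have := hC 0
    simp only [range_zero, prod_empty, pow_zero, mul_one] at this
    linarith

lemma poch_succ (x : ℂ) (n : ℕ) : poch x (n + 1) = poch x n * (x + n) := by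
  simp [poch, ascPochhammer_succ_right]

lemma poch_ne_zero {x : ℂ} {n : ℕ} (hx : ∀ j : ℕ, x + j ≠ 0) : poch x n ≠ 0 := by
  induction n with
  | zero => simp [poch]
  | succ n ih => rw [poch_succ]; exact mul_ne_zero ih (hx n)

lemma poch_zero (x : ℂ) : poch x 0 = 1 := by simp [poch]

lemma natCast_add_ne_zero {x : ℝ} (hx : 0 < x) (n : ℕ) : (n : ℂ) + (x : ℂ) ≠ 0 := by
  have : (0 : ℝ) < n + x := by positivity
  exact_mod_cast this.ne'

lemma root_sq (ρ h : ℝ) : root ρ h ^ 2 = h / (4 * (1 + (ρ : ℂ) ^ 2)) := by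
  have : root ρ h ^ 2 = ((h / (4 * (1 + ρ ^ 2)) : ℝ) : ℂ) := by
    rw [root, one_div]
    exact Complex.cpow_nat_inv_pow _ two_ne_zero
  rw [this]
  push_cast
  rfl

lemma sq_ne_root_sq {ρ h : ℝ} (hh : ∀ m : ℕ, 2 ≤ m → h ≠ 4 * (1 + ρ ^ 2) * (m : ℝ) ^ 2)
    {m : ℕ} (hm : 2 ≤ m) : (m : ℂ) ^ 2 ≠ root ρ h ^ 2 := by
  intro he
  rw [root_sq] at he
  have hρ : (0 : ℝ) < 4 * (1 + ρ ^ 2) := by positivity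
  have he' : (m : ℝ) ^ 2 = h / (4 * (1 + ρ ^ 2)) := by exact_mod_cast he
  apply hh m hm
  rw [he']
  field_simp

lemma deltaMinus_add_ne_zero {ρ h : ℝ}
    (hh : ∀ m : ℕ, 2 ≤ m → h ≠ 4 * (1 + ρ ^ 2) * (m : ℝ) ^ 2) (k j : ℕ) :
    DeltaMinus ρ h (k + 1) + j ≠ 0 := by
  intro he
  refine sq_ne_root_sq hh (m := 2 * (k + 1) + j) (by omega) ?_
  have : root ρ h = ((2 * (k + 1) + j : ℕ) : ℂ) := by
    rw [DeltaMinus] at he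
    push_cast at he ⊢
    linear_combination -he
  rw [this]

lemma deltaPlus_add_ne_zero {ρ h : ℝ}
    (hh : ∀ m : ℕ, 2 ≤ m → h ≠ 4 * (1 + ρ ^ 2) * (m : ℝ) ^ 2) (k j : ℕ) :
    DeltaPlus ρ h (k + 1) + j ≠ 0 := by
  intro he
  refine sq_ne_root_sq hh (m := 2 * (k + 1) + j) (by omega) ?_
  have : root ρ h = -((2 * (k + 1) + j : ℕ) : ℂ) := by
    rw [DeltaPlus] at he
    push_cast at he ⊢
    linear_combination he
  rw [this, neg_sq]

lemma rWeight_succ (ρ h : ℝ) (k p i : ℕ) :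
    rWeight ρ h k p (i + 1) = stepEta ρ h (i + 2 * k) * rWeight ρ h k p i := by
  rw [rWeight, rWeight, stepEta, div_mul_div_comm]
  simp only [poch_succ, DeltaMinus, DeltaPlus]
  push_cast
  congr 1 <;> ring

lemma tWeight_succ (α : ℝ) (k p i : ℕ) :
    tWeight α k p (i + 1) = stepZ α (2 * i + k) * tWeight α k p i := by
  have : stepZ α (2 * i + k) = ((k / 2 - α / 4 + i) * (k / 2 + α / 4 + 1 / 4 + i)) /
      ((k / 2 + 1 + i) * (k / 2 + 3 / 4 + i)) := by
    rw [stepZ, ← mul_div_mul_left _ ((k / 2 + 1 + i) * (k / 2 + 3 / 4 + i) : ℂ)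
      (by norm_num : (4 : ℂ) ≠ 0)]
    push_cast
    congr 1 <;> ring
  rw [tWeight, tWeight, this, div_mul_div_comm]
  simp only [poch_succ]
  congr 1 <;> ring

lemma rFactor_eq (α : ℝ) (k i : ℕ) : rFactor α k i = stepZ α (i + 2 * k) := by
  rw [rFactor, stepZ]
  push_cast
  rfl

lemma tFactor_eq (ρ h : ℝ) (k i : ℕ) : tFactor ρ h k i = stepEta ρ h (2 * i + k) := by
  have hnum : (((2 * i + k : ℕ) : ℂ) - root ρ h) * ((2 * i + k : ℕ) + root ρ h) =
      4 * ((i + k / 2) ^ 2 - h / (16 * (1 + (ρ : ℂ) ^ 2))) := by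
    have h16 : (h : ℂ) / (16 * (1 + (ρ : ℂ) ^ 2)) = h / (4 * (1 + (ρ : ℂ) ^ 2)) / 4 := by
      rw [div_div]
      congr 1
      ring
    rw [h16, ← root_sq]
    push_cast
    ring
  have hden : (((2 * i + k : ℕ) : ℂ) + 1) * ((2 * i + k : ℕ) + 1 / 2) =
      4 * ((i + k / 2 + 1 / 2) * (i + k / 2 + 1 / 4)) := by
    push_cast
    ring
  rw [stepEta, hnum, hden, mul_div_mul_left _ _ (by norm_num : (4 : ℂ) ≠ 0), tFactor]

lemma norm_rWeight_self_le (ρ h : ℝ) (k p : ℕ) : ‖rWeight ρ h k p p‖ ≤ 1 := by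
  rw [rWeight, norm_div]
  exact div_self_le_one _

lemma norm_tWeight_self_le (α : ℝ) (k p : ℕ) : ‖tWeight α k p p‖ ≤ 1 := by
  rw [tWeight, norm_div]
  exact div_self_le_one _

lemma isPathWeight_rWeight {ρ h : ℝ}
    (hh : ∀ m : ℕ, 2 ≤ m → h ≠ 4 * (1 + ρ ^ 2) * (m : ℝ) ^ 2) :
    IsPathWeight (rWeight ρ h) fun k i => stepEta ρ h (i + 2 * k) where
  succ k p j := rWeight_succ ρ h k p (p + j)
  zero := by simp [rWeight, poch_zero]
  -- Rows `k + 1` suffice, since row `0` is only entered at `p = 0`. Hence only `m ≥ 2` has to be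
  -- excluded in `hh`.
  self k p := by
    refine div_self ?_
    refine mul_ne_zero (mul_ne_zero (mul_ne_zero ?_ ?_) ?_) ?_
    · exact poch_ne_zero (deltaMinus_add_ne_zero hh k)
    · exact poch_ne_zero (deltaPlus_add_ne_zero hh k)
    · refine poch_ne_zero fun j => ?_
      have := natCast_add_ne_zero one_pos (2 * (k + 1) + j)
      push_cast at this ⊢
      rwa [add_right_comm]
    · refine poch_ne_zero fun j => ?_
      have := natCast_add_ne_zero (one_half_pos (α := ℝ)) (2 * (k + 1) + j)
      push_cast at this ⊢
      rwa [add_right_comm]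

lemma isPathWeight_tWeight {α : ℝ}
    (hα : ∀ m : ℕ, 1 ≤ m → α ≠ 2 * (m : ℝ) ∧ α ≠ -(2 * (m : ℝ) + 1)) :
    IsPathWeight (tWeight α) fun k i => stepZ α (2 * i + k) where
  succ k p j := tWeight_succ α k p (p + j)
  zero := by simp [tWeight, poch_zero]
  self k p := by
    refine div_self ?_
    refine mul_ne_zero (mul_ne_zero (mul_ne_zero ?_ ?_) ?_) ?_
    -- A zero of `(k + 1) / 2 - α / 4 + j` means `α = 2 (k + 1 + 2j)`; the next factor likewise
    -- gives `α = -(2 (k + 1 + 2j) + 1)`.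
    · refine poch_ne_zero fun j he => (hα (k + 1 + 2 * j) (by omega)).1 ?_
      have he' : ((k + 1 : ℕ) : ℝ) / 2 - α / 4 + j = 0 := by
        apply Complex.ofReal_injective
        push_cast at he ⊢
        exact he
      push_cast at he' ⊢
      linarith
    · refine poch_ne_zero fun j he => (hα (k + 1 + 2 * j) (by omega)).2 ?_
      have he' : ((k + 1 : ℕ) : ℝ) / 2 + α / 4 + 1 / 4 + j = 0 := by
        apply Complex.ofReal_injective
        push_cast at he ⊢
        exact he
      push_cast at he' ⊢
      linarith
    · refine poch_ne_zero fun j => ?_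
      have : (0 : ℝ) < ((k + 1 : ℕ) : ℝ) / 2 + 1 + j := by positivity
      have := Complex.ofReal_ne_zero.2 this.ne'
      push_cast at this ⊢
      exact this
    · refine poch_ne_zero fun j => ?_
      have : (0 : ℝ) < ((k + 1 : ℕ) : ℝ) / 2 + 3 / 4 + j := by positivity
      have := Complex.ofReal_ne_zero.2 this.ne'
      push_cast at this ⊢
      exact this

lemma exists_majorant (ρ α h : ℝ) {R : ℝ} (hR : 1 < R) :
    (∃ Q, Majorant (rWeight ρ h) (rFactor α) Q ∧ GrowsAtMost Q R) ∧
    (∃ Q, Majorant (tWeight α) (tFactor ρ h) Q ∧ GrowsAtMost Q R) := by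
  -- The position is at most twice the number of steps, so `P` may grow only like powers of `√R`.
  -- Monotonicity of `P` absorbs the extra unit by which a `z`-step advances.
  have hr : 1 < √R := by rwa [Real.lt_sqrt zero_le_one, one_pow]
  have hr2 : √R ^ 2 = R := Real.sq_sqrt (by linarith)
  obtain ⟨P, hpos, hmono, hEta, hZ, C, hC0, hC⟩ := exists_potential ρ α h hr
  have hCle : ∀ {n k i : ℕ}, n ≤ 2 * (k + i) → P n ≤ C * R ^ (k + i) := fun {n k i} hn => by
    refine (hC n).trans ?_
    rw [show R ^ (k + i) = √R ^ (2 * (k + i)) by rw [pow_mul, hr2]]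
    gcongr
    exact hr.le
  refine ⟨⟨fun k i => P (i + 2 * k), Majorant.of_step (f := fun k i => stepEta ρ h (i + 2 * k))
      (fun _ _ => hpos _) (norm_rWeight_self_le ρ h) (fun k p j => rWeight_succ ρ h k p (p + j))
      (fun k i => ?_) (fun k i => ?_), C, fun k i => hCle (by omega)⟩,
    ⟨fun k i => P (2 * i + k), Majorant.of_step (f := fun k i => stepZ α (2 * i + k))
      (fun _ _ => hpos _) (norm_tWeight_self_le α) (fun k p j => tWeight_succ α k p (p + j))
      (fun k i => ?_) (fun k i => ?_), C, fun k i => hCle (by omega)⟩⟩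
  · exact (hEta _).trans (hmono (by omega))
  · rw [rFactor_eq]; exact (hZ _).trans (hmono (by omega))
  · exact (hZ _).trans (hmono (by omega))
  · rw [tFactor_eq]; exact (hEta _).trans (hmono (by omega))

lemma exists_one_lt_mul_lt_one {x : ℝ} (hx0 : 0 ≤ x) (hx : x < 1) : ∃ R, 1 < R ∧ R * x < 1 := by
  refine ⟨2 / (1 + x), ?_, ?_⟩
  · rw [lt_div_iff₀ (by linarith)]; linarith
  · rw [div_mul_eq_mul_div, div_lt_one (by linarith)]; linarith

/-- The coefficient of `η ^ l * z ^ m` in the local solution. -/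
def lameCoeff (ρ α h : ℝ) (m l : ℕ) : ℂ :=
  pathCoeff (fun k i => stepEta ρ h (i + 2 * k)) (rFactor α) m l

theorem summable_lameCoeff {ρ α h : ℝ}
    (hh : ∀ m : ℕ, 2 ≤ m → h ≠ 4 * (1 + ρ ^ 2) * (m : ℝ) ^ 2) {t u : ℂ} (htu : ‖t‖ + ‖u‖ < 1) :
    Summable fun x : ℕ × ℕ => lameCoeff ρ α h x.1 x.2 * t ^ x.2 * u ^ x.1 := by
  obtain ⟨R, hR1, hR⟩ := exists_one_lt_mul_lt_one (by positivity) htu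
  obtain ⟨Q, hQ, hg⟩ := (exists_majorant ρ α h hR1).1
  exact hQ.summable_pathCoeff (isPathWeight_rWeight hh) hg (by linarith) hR

theorem nestedConverges_rWeight {ρ α h : ℝ}
    (hh : ∀ m : ℕ, 2 ≤ m → h ≠ 4 * (1 + ρ ^ 2) * (m : ℝ) ^ 2) {t u : ℂ} (htu : ‖t‖ + ‖u‖ < 1) :
    NestedConverges (rWeight ρ h) (rFactor α) t u ∧
      ∑' n, nestedSum (rWeight ρ h) (rFactor α) t n 0 0 * u ^ n =
        ∑' x : ℕ × ℕ, lameCoeff ρ α h x.1 x.2 * t ^ x.2 * u ^ x.1 := by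
  obtain ⟨R, hR1, hR⟩ := exists_one_lt_mul_lt_one (by positivity) htu
  obtain ⟨Q, hQ, hg⟩ := (exists_majorant ρ α h hR1).1
  have := hQ.nestedSum_eq (isPathWeight_rWeight hh) hg (by linarith) hR
  exact ⟨this.1, this.2.tsum_eq⟩

theorem nestedConverges_tWeight {ρ α h : ℝ}
    (hα : ∀ m : ℕ, 1 ≤ m → α ≠ 2 * (m : ℝ) ∧ α ≠ -(2 * (m : ℝ) + 1)) {t u : ℂ}
    (htu : ‖u‖ + ‖t‖ < 1) :
    NestedConverges (tWeight α) (tFactor ρ h) t u ∧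
      ∑' n, nestedSum (tWeight α) (tFactor ρ h) t n 0 0 * u ^ n =
        ∑' x : ℕ × ℕ, lameCoeff ρ α h x.1 x.2 * u ^ x.2 * t ^ x.1 := by
  rw [add_comm] at htu
  obtain ⟨R, hR1, hR⟩ := exists_one_lt_mul_lt_one (by positivity) htu
  obtain ⟨Q, hQ, hg⟩ := (exists_majorant ρ α h hR1).2
  have := hQ.nestedSum_eq (isPathWeight_tWeight hα) hg (by linarith) hR
  refine ⟨this.1, this.2.tsum_eq.trans ?_⟩
  rw [← (Equiv.prodComm ℕ ℕ).tsum_eq]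
  refine tsum_congr fun x => ?_
  have hsw := pathCoeff_swap (fun k i => stepEta ρ h (i + 2 * k)) (rFactor α) x.1 x.2
  have hf : (fun k i => rFactor α i k) = fun k i => stepZ α (2 * i + k) := by
    funext k i; rw [rFactor_eq, add_comm]
  have hb : (fun k i => stepEta ρ h (k + 2 * i)) = tFactor ρ h := by
    funext k i; rw [tFactor_eq, add_comm]
  rw [hf, hb] at hsw
  simp only [Equiv.prodComm_apply, Prod.fst_swap, Prod.snd_swap, lameCoeff, hsw]
  ring


/-! ### Collecting powers of `ξ`: the three-term recurrence. -/

lemma lameCoeff_zero_zero (ρ α h : ℝ) : lameCoeff ρ α h 0 0 = 1 := by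
  simp [lameCoeff, pathCoeff]

lemma lameCoeff_zero_succ (ρ α h : ℝ) (l : ℕ) :
    lameCoeff ρ α h 0 (l + 1) = stepEta ρ h l * lameCoeff ρ α h 0 l := by
  simp [lameCoeff, pathCoeff]

lemma lameCoeff_succ_zero (ρ α h : ℝ) (m : ℕ) :
    lameCoeff ρ α h (m + 1) 0 = stepZ α (2 * m) * lameCoeff ρ α h m 0 := by
  simp [lameCoeff, pathCoeff, rFactor_eq]

lemma lameCoeff_succ_succ (ρ α h : ℝ) (m l : ℕ) :
    lameCoeff ρ α h (m + 1) (l + 1) =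
      stepEta ρ h (l + 2 * (m + 1)) * lameCoeff ρ α h (m + 1) l +
        stepZ α (l + 1 + 2 * m) * lameCoeff ρ α h m (l + 1) := by
  simp [lameCoeff, pathCoeff, rFactor_eq]

/-- The contribution of `z ^ m` to the coefficient of `ξ ^ n` in the local solution. -/
def lameTerm (ρ α h : ℝ) (m n : ℕ) : ℂ :=
  if 2 * m ≤ n then
    lameCoeff ρ α h m (n - 2 * m) * (1 + (ρ : ℂ) ^ 2) ^ (n - 2 * m) * (-(ρ : ℂ) ^ 2) ^ m
  else 0

lemma lameTerm_add (ρ α h : ℝ) (m l : ℕ) :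
    lameTerm ρ α h m (l + 2 * m) =
      lameCoeff ρ α h m l * (1 + (ρ : ℂ) ^ 2) ^ l * (-(ρ : ℂ) ^ 2) ^ m := by
  simp [lameTerm]

lemma lameTerm_of_lt (ρ α h : ℝ) {m n : ℕ} (hn : n < 2 * m) : lameTerm ρ α h m n = 0 :=
  if_neg (by omega)

lemma lameTerm_zero_succ (ρ α h : ℝ) (n : ℕ) :
    lameTerm ρ α h 0 (n + 1) = (1 + (ρ : ℂ) ^ 2) * stepEta ρ h n * lameTerm ρ α h 0 n := by
  simp only [lameTerm, mul_zero, Nat.zero_le, if_true, Nat.sub_zero, lameCoeff_zero_succ]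
  ring

lemma lameTerm_succ (ρ α h : ℝ) (m n : ℕ) :
    lameTerm ρ α h (m + 1) (n + 2) =
      (1 + (ρ : ℂ) ^ 2) * stepEta ρ h (n + 1) * lameTerm ρ α h (m + 1) (n + 1) +
        -(ρ : ℂ) ^ 2 * stepZ α n * lameTerm ρ α h m n := by
  rcases lt_or_ge n (2 * m) with hn | hn
  · rw [lameTerm_of_lt _ _ _ hn, lameTerm_of_lt, lameTerm_of_lt] <;> first | omega | simp
  · obtain ⟨l, rfl⟩ := Nat.exists_eq_add_of_le' hn
    rw [show l + 2 * m + 2 = l + 2 * (m + 1) by ring, lameTerm_add, lameTerm_add]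
    rcases l with _ | l
    -- At `n = 2m` the endpoint is the first of its row, so it is reached only by a `z`-step.
    · rw [lameTerm_of_lt _ _ _ (by omega : 0 + 2 * m + 1 < 2 * (m + 1)), lameCoeff_succ_zero,
        zero_add]
      ring
    · rw [show l + 1 + 2 * m + 1 = l + 2 * (m + 1) by ring, lameTerm_add, lameCoeff_succ_succ]
      ring

/-- The coefficient of `ξ ^ n` in the local solution. -/
def lameSeries (ρ α h : ℝ) (n : ℕ) : ℂ := ∑ m ∈ range (n + 1), lameTerm ρ α h m n

lemma sum_lameTerm (ρ α h : ℝ) {n N : ℕ} (hN : n < N) :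
    ∑ m ∈ range N, lameTerm ρ α h m n = lameSeries ρ α h n := by
  refine (sum_subset (range_mono hN) fun m _ hm => lameTerm_of_lt _ _ _ ?_).symm
  have := mt mem_range.2 hm
  omega

lemma lameSeries_zero (ρ α h : ℝ) : lameSeries ρ α h 0 = 1 := by
  simp [lameSeries, lameTerm, lameCoeff_zero_zero]

lemma lameSeries_one (ρ α h : ℝ) :
    lameSeries ρ α h 1 = (1 + (ρ : ℂ) ^ 2) * stepEta ρ h 0 * lameSeries ρ α h 0 := by
  rw [lameSeries, sum_range_succ, lameTerm_of_lt (m := 1) _ _ _ (by norm_num), lameSeries]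
  simp only [zero_add, sum_range_one, add_zero]
  exact lameTerm_zero_succ ρ α h 0

lemma lameSeries_add_two (ρ α h : ℝ) (n : ℕ) :
    lameSeries ρ α h (n + 2) =
      (1 + (ρ : ℂ) ^ 2) * stepEta ρ h (n + 1) * lameSeries ρ α h (n + 1) +
        -(ρ : ℂ) ^ 2 * stepZ α n * lameSeries ρ α h n := by
  -- Padding with vanishing terms gives the sums compatible ranges; then the row `m = 0`, which no
  -- `z`-step enters, is split off.
  rw [lameSeries, ← sum_lameTerm ρ α h (show n + 1 < n + 2 + 1 by omega),
    ← sum_lameTerm ρ α h (show n < n + 2 by omega), sum_range_succ', sum_range_succ' _ (n + 2),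
    lameTerm_zero_succ]
  simp only [lameTerm_succ, sum_add_distrib, ← mul_sum]
  ring

/-- The double series is reindexed by `(m, l) ↦ (l + 2m, m)`; pairs outside the image carry zero
terms, and each power of `ξ` receives finitely many. -/
theorem hasSum_lameSeries {ρ α h : ℝ}
    (hh : ∀ m : ℕ, 2 ≤ m → h ≠ 4 * (1 + ρ ^ 2) * (m : ℝ) ^ 2) {ξ : ℂ} (hξ : ξ ∈ domain ρ) :
    HasSum (fun n => lameSeries ρ α h n * ξ ^ n) (LFR ρ α h ξ) := by
  have hξ' : ‖eta ρ ξ‖ + ‖zvar ρ ξ‖ < 1 := hξ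
  have hs := (summable_lameCoeff (α := α) hh hξ').hasSum
  rw [← (nestedConverges_rWeight hh hξ').2] at hs
  let ι : ℕ × ℕ → ℕ × ℕ := fun x => (x.2 + 2 * x.1, x.1)
  have hι : Function.Injective ι := by
    rintro ⟨a, b⟩ ⟨c, d⟩ hab
    simp only [ι, Prod.mk.injEq] at hab ⊢
    omega
  let g : ℕ × ℕ → ℂ := fun x => lameTerm ρ α h x.2 x.1 * ξ ^ x.1
  have hg : HasSum g (LFR ρ α h ξ) := by
    rw [← hι.hasSum_iff]
    · convert! hs using 2 with x
      simp only [Function.comp, g, ι, lameTerm_add, eta, zvar, mul_pow]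
      ring
    · rintro ⟨n, m⟩ hx
      have : n < 2 * m := by
        by_contra hc
        exact hx ⟨(m, n - 2 * m), by simp only [ι, Prod.mk.injEq, and_true]; omega⟩
      simp [g, lameTerm_of_lt _ _ _ this]
  refine hg.prod_fiberwise fun n => ?_
  rw [lameSeries, sum_mul]
  refine hasSum_sum_of_ne_finset_zero fun m hm => ?_
  have := mt mem_range.2 hm
  simp only [g]
  rw [lameTerm_of_lt _ _ _ (by omega), zero_mul]


/-! ### Lamé's operator acting on power series. -/

section PowerSeries

variable {c : ℕ → ℂ} {y : ℂ → ℂ} {r : ℝ}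

lemma hasFPowerSeriesOnBall_of_hasSum (hr : 0 < r)
    (hy : ∀ ξ ∈ Metric.ball (0 : ℂ) r, HasSum (fun n => c n * ξ ^ n) (y ξ)) :
    HasFPowerSeriesOnBall y (FormalMultilinearSeries.ofScalars ℂ c) 0 (ENNReal.ofReal r) where
  r_le := by
    refine ENNReal.le_of_forall_nnreal_lt fun s hs => ?_
    refine FormalMultilinearSeries.le_radius_of_summable _ ?_
    have hs' : (s : ℝ) < r := by
      rw [← ENNReal.ofReal_coe_nnreal] at hs
      exact (ENNReal.ofReal_lt_ofReal_iff hr).1 hs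
    have := (hy (s : ℝ) (by simpa using hs')).summable.norm
    simpa [FormalMultilinearSeries.ofScalars_norm] using this
  r_pos := by simpa using hr
  hasSum := by
    intro ξ hξ
    rw [Metric.eball_ofReal] at hξ
    simpa [FormalMultilinearSeries.ofScalars_apply_eq, mul_comm] using hy ξ hξ

lemma hasSum_deriv (hr : 0 < r)
    (hy : ∀ ξ ∈ Metric.ball (0 : ℂ) r, HasSum (fun n => c n * ξ ^ n) (y ξ)) :
    ∀ ξ ∈ Metric.ball (0 : ℂ) r,
      HasSum (fun n : ℕ => ((n + 1) * c (n + 1)) * ξ ^ n) (deriv y ξ) := by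
  intro ξ hξ
  have h := (hasFPowerSeriesOnBall_of_hasSum hr hy).fderiv.hasSum (y := ξ)
    (by rwa [Metric.eball_ofReal])
  have h1 := h.mapL (ContinuousLinearMap.apply ℂ ℂ (1 : ℂ))
  simp only [zero_add, ContinuousLinearMap.apply_apply, fderiv_apply_one_eq_deriv] at h1
  convert! h1 using 2 with n
  rw [FormalMultilinearSeries.apply_eq_pow_smul_coeff, smul_apply,
    FormalMultilinearSeries.derivSeries_coeff_one, FormalMultilinearSeries.coeff_ofScalars]
  simp only [nsmul_eq_mul, smul_eq_mul]
  push_cast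
  ring

lemma hasSum_of_shift {g : ℕ → ℂ} {a : ℂ} (h0 : g 0 = 0) (h : HasSum (fun n => g (n + 1)) a) :
    HasSum g a := by
  simpa [h0] using (hasSum_nat_add_iff 1).1 h

lemma hasSum_mul_deriv {y' ξ : ℂ} (h : HasSum (fun n : ℕ => ((n + 1) * c (n + 1)) * ξ ^ n) y') :
    HasSum (fun n : ℕ => (n * c n) * ξ ^ n) (ξ * y') := by
  refine hasSum_of_shift (by simp) ?_
  convert! h.mul_left ξ using 2 with n
  push_cast
  ring

/-- Lamé's operator in algebraic form, cleared of denominators. -/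
def lameOp (ρ α h : ℝ) (y : ℂ → ℂ) (ξ : ℂ) : ℂ :=
  ξ * (1 - ξ) * (1 - (ρ : ℂ) ^ 2 * ξ) * deriv (deriv y) ξ
    + 1 / 2 * (1 - 2 * (1 + (ρ : ℂ) ^ 2) * ξ + 3 * (ρ : ℂ) ^ 2 * ξ ^ 2) * deriv y ξ
    + 1 / 4 * (h - α * (α + 1) * (ρ : ℂ) ^ 2 * ξ) * y ξ

lemma lameEqAt_iff {ρ α h : ℝ} (hρ : ρ ≠ 0) {ξ : ℂ} (h0 : ξ ≠ 0) (h1 : ξ ≠ 1)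
    (h2 : (ρ : ℂ) ^ 2 * ξ ≠ 1) : LameEqAt ρ α h y ξ ↔ lameOp ρ α h y ξ = 0 := by
  have hρ' : (ρ : ℂ) ≠ 0 := Complex.ofReal_ne_zero.2 hρ
  have h1' : ξ - 1 ≠ 0 := sub_ne_zero.2 h1
  have h2' : ξ - ((ρ : ℂ) ^ 2)⁻¹ ≠ 0 := by
    intro he
    apply h2
    rw [sub_eq_zero.1 he]
    field_simp
  have h3' : (ρ : ℂ) ^ 2 * ξ - 1 ≠ 0 := sub_ne_zero.2 h2
  have hinv : ξ - ((ρ : ℂ) ^ 2)⁻¹ = ((ρ : ℂ) ^ 2 * ξ - 1) / (ρ : ℂ) ^ 2 := by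
    field_simp
  have key : lameOp ρ α h y ξ = ξ * (ξ - 1) * ((ρ : ℂ) ^ 2 * ξ - 1) * (deriv (deriv y) ξ
    + 1 / 2 * (1 / ξ + 1 / (ξ - 1) + 1 / (ξ - ((ρ : ℂ) ^ 2)⁻¹)) * deriv y ξ
    + (-(α * (α + 1)) * ξ + h * ((ρ : ℂ) ^ 2)⁻¹) /
        (4 * ξ * (ξ - 1) * (ξ - ((ρ : ℂ) ^ 2)⁻¹)) * y ξ) := by
    have h4' : ξ * (ρ : ℂ) ^ 2 - 1 ≠ 0 := by rwa [mul_comm]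
    rw [lameOp, hinv]
    field_simp
    ring
  rw [key, LameEqAt]
  simp [h0, h1', h3']

/-- The coefficients of the power series of `lameOp ρ α h y`, where `y` has coefficients `c`. -/
def opCoeff (ρ α h : ℝ) (c : ℕ → ℂ) (n : ℕ) : ℂ :=
  (n + 1) * (n + 1 / 2) * c (n + 1) - ((1 + (ρ : ℂ) ^ 2) * n ^ 2 - h / 4) * c n
    + match n with
      | 0 => 0
      | k + 1 => (ρ : ℂ) ^ 2 * (k * (k + 1 / 2) - α * (α + 1) / 4) * c k

theorem hasSum_lameOp (ρ α h : ℝ) (hr : 0 < r)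
    (hy : ∀ ξ ∈ Metric.ball (0 : ℂ) r, HasSum (fun n => c n * ξ ^ n) (y ξ)) :
    ∀ ξ ∈ Metric.ball (0 : ℂ) r,
      HasSum (fun n => opCoeff ρ α h c n * ξ ^ n) (lameOp ρ α h y ξ) := by
  intro ξ hξ
  have s0 := hy ξ hξ
  have s1 := hasSum_deriv hr hy ξ hξ
  have e1 := hasSum_mul_deriv s1
  have s2 := hasSum_deriv (c := fun n => (n + 1) * c (n + 1)) hr (hasSum_deriv hr hy) ξ hξ
  have e2 := hasSum_mul_deriv (c := fun n => (n + 1) * c (n + 1)) s2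
  have e3 : HasSum (fun n : ℕ => (n * (n - 1) * c n) * ξ ^ n) (ξ ^ 2 * deriv (deriv y) ξ) := by
    refine hasSum_of_shift (by simp) ?_
    convert! e2.mul_left ξ using 1
    · funext n
      push_cast
      ring
    · ring
  -- Terms of the operator are grouped by their shift of degree: `hA` lowers it by one or keeps it,
  -- `hB` raises it by one.
  have hA := (e2.add (s1.mul_left (1 / 2))).sub
    (((e3.add e1).mul_left (1 + (ρ : ℂ) ^ 2)).sub (s0.mul_left ((h : ℂ) / 4)))
  have hB := ((e3.add (e1.mul_left (3 / 2))).sub (s0.mul_left ((α : ℂ) * (α + 1) / 4))).mul_left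
    ((ρ : ℂ) ^ 2 * ξ)
  have hC : HasSum (fun n => (match n with
      | 0 => 0
      | k + 1 => (ρ : ℂ) ^ 2 * (k * (k + 1 / 2) - α * (α + 1) / 4) * c k) * ξ ^ n) _ :=
    hasSum_of_shift (by simp) (by
      convert! hB using 2 with n
      ring)
  convert! hA.add hC using 1
  · funext n
    rw [opCoeff.eq_def]
    ring
  · rw [lameOp]
    ring

end PowerSeries

/-! ### The Frobenius solution and its uniqueness. -/

lemma one_add_sq_ne_zero (ρ : ℝ) : (1 + (ρ : ℂ) ^ 2) ≠ 0 := by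
  have : (0 : ℝ) < 1 + ρ ^ 2 := by positivity
  exact_mod_cast this.ne'

lemma stepEta_mul (ρ h : ℝ) (n : ℕ) :
    (1 + (ρ : ℂ) ^ 2) * stepEta ρ h n * ((n + 1) * (n + 1 / 2)) =
      (1 + (ρ : ℂ) ^ 2) * n ^ 2 - h / 4 := by
  have h1 : ((n : ℂ) + 1) ≠ 0 := by simpa using natCast_add_ne_zero one_pos n
  have h2 : ((n : ℂ) + 1 / 2) ≠ 0 := by simpa using natCast_add_ne_zero (one_half_pos (α := ℝ)) n
  have h3 := one_add_sq_ne_zero ρ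
  rw [stepEta, mul_assoc, div_mul_cancel₀ _ (mul_ne_zero h1 h2)]
  have : ((n : ℂ) - root ρ h) * (n + root ρ h) = n ^ 2 - h / (4 * (1 + (ρ : ℂ) ^ 2)) := by
    rw [← root_sq]; ring
  rw [this]
  field_simp

lemma stepZ_mul (α : ℝ) (n : ℕ) :
    stepZ α n * ((n + 2) * (n + 3 / 2)) = n * (n + 1 / 2) - α * (α + 1) / 4 := by
  have h1 : ((n : ℂ) + 2) ≠ 0 := by simpa using natCast_add_ne_zero two_pos n
  have h2 : ((n : ℂ) + 3 / 2) ≠ 0 := by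
    simpa using natCast_add_ne_zero (show (0 : ℝ) < 3 / 2 by norm_num) n
  rw [stepZ, div_mul_cancel₀ _ (mul_ne_zero h1 h2)]
  ring

lemma opCoeff_zero_eq (ρ α h : ℝ) (c : ℕ → ℂ) :
    opCoeff ρ α h c 0 = 1 / 2 * (c 1 - (1 + (ρ : ℂ) ^ 2) * stepEta ρ h 0 * c 0) := by
  have := stepEta_mul ρ h 0
  simp only [opCoeff, Nat.cast_zero, zero_add] at this ⊢
  linear_combination c 0 * this

/-- The prefactor is the indicial polynomial `s (s - 1/2)` at `s = n + 2`. It never vanishes, so the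
equation determines `c (n + 2)`. -/
lemma opCoeff_succ_eq (ρ α h : ℝ) (c : ℕ → ℂ) (n : ℕ) :
    opCoeff ρ α h c (n + 1) = (n + 2) * (n + 3 / 2) *
      (c (n + 2) - ((1 + (ρ : ℂ) ^ 2) * stepEta ρ h (n + 1) * c (n + 1) +
        -(ρ : ℂ) ^ 2 * stepZ α n * c n)) := by
  have h1 := stepEta_mul ρ h (n + 1)
  have h2 := stepZ_mul α n
  simp only [opCoeff]
  push_cast at h1 ⊢
  linear_combination c (n + 1) * h1 - (ρ : ℂ) ^ 2 * c n * h2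

lemma opCoeff_lameSeries (ρ α h : ℝ) (n : ℕ) : opCoeff ρ α h (lameSeries ρ α h) n = 0 := by
  rcases n with _ | n
  · rw [opCoeff_zero_eq, lameSeries_one, sub_self, mul_zero]
  · rw [opCoeff_succ_eq, lameSeries_add_two, sub_self, mul_zero]

lemma eq_lameSeries_of_opCoeff_eq_zero {ρ α h : ℝ} {c : ℕ → ℂ} (h0 : c 0 = 1)
    (hc : ∀ n, opCoeff ρ α h c n = 0) (n : ℕ) : c n = lameSeries ρ α h n := by
  induction n using Nat.strong_induction_on with
  | _ n ih =>
    match n with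
    | 0 => rw [h0, lameSeries_zero]
    | 1 =>
      have := hc 0
      rw [opCoeff_zero_eq, mul_eq_zero, or_iff_right (by norm_num), sub_eq_zero] at this
      rw [this, lameSeries_one, ih 0 one_pos]
    | n + 2 =>
      have h1 : ((n : ℂ) + 2) ≠ 0 := by simpa using natCast_add_ne_zero two_pos n
      have h2 : ((n : ℂ) + 3 / 2) ≠ 0 := by
        simpa using natCast_add_ne_zero (show (0 : ℝ) < 3 / 2 by norm_num) n
      have := hc (n + 1)
      rw [opCoeff_succ_eq, mul_eq_zero, or_iff_right (mul_ne_zero h1 h2), sub_eq_zero] at this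
      rw [this, lameSeries_add_two, ih n (by omega), ih (n + 1) (by omega)]

lemma norm_eta_add_norm_zvar (ρ : ℝ) (ξ : ℂ) :
    ‖eta ρ ξ‖ + ‖zvar ρ ξ‖ = (1 + ρ ^ 2) * ‖ξ‖ + ρ ^ 2 * ‖ξ‖ ^ 2 := by
  have h1 : ‖(1 + (ρ : ℂ) ^ 2)‖ = 1 + ρ ^ 2 := by
    have : (1 + (ρ : ℂ) ^ 2) = ((1 + ρ ^ 2 : ℝ) : ℂ) := by push_cast; rfl
    rw [this, Complex.norm_real, Real.norm_of_nonneg (by positivity)]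
  rw [eta, zvar, norm_mul, norm_mul, h1, norm_neg, norm_pow, norm_pow, Complex.norm_real,
    Real.norm_eq_abs, sq_abs]

lemma isOpen_domain (ρ : ℝ) : IsOpen (domain ρ) := by
  have : Continuous fun ξ : ℂ => ‖eta ρ ξ‖ + ‖zvar ρ ξ‖ := by
    unfold eta zvar
    fun_prop
  exact isOpen_lt this continuous_const

lemma zero_mem_domain (ρ : ℝ) : (0 : ℂ) ∈ domain ρ := by simp [domain, eta, zvar]

lemma norm_lt_one_of_mem_domain {ρ : ℝ} {ξ : ℂ} (hξ : ξ ∈ domain ρ) : ‖ξ‖ < 1 := by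
  have h : ‖eta ρ ξ‖ + ‖zvar ρ ξ‖ < 1 := hξ
  rw [norm_eta_add_norm_zvar] at h
  nlinarith [mul_nonneg (sq_nonneg ρ) (norm_nonneg ξ), mul_nonneg (sq_nonneg ρ) (sq_nonneg ‖ξ‖)]

lemma exists_ball_subset_domain {ρ : ℝ} {ξ : ℂ} (hξ : ξ ∈ domain ρ) :
    ∃ r, 0 < r ∧ ξ ∈ Metric.ball (0 : ℂ) r ∧ Metric.ball (0 : ℂ) r ⊆ domain ρ := by
  have h : ‖eta ρ ξ‖ + ‖zvar ρ ξ‖ < 1 := hξ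
  rw [norm_eta_add_norm_zvar] at h
  have hcont : Continuous fun s : ℝ => (1 + ρ ^ 2) * s + ρ ^ 2 * s ^ 2 := by fun_prop
  have hev := (hcont.tendsto ‖ξ‖).eventually_lt_const h
  obtain ⟨r, hr, hr'⟩ := ((hev.filter_mono nhdsWithin_le_nhds).and
    (self_mem_nhdsWithin : Set.Ioi ‖ξ‖ ∈ 𝓝[>] ‖ξ‖)).exists
  have hr' : ‖ξ‖ < r := hr'
  refine ⟨r, (norm_nonneg ξ).trans_lt hr', by simpa using hr', fun ζ hζ => ?_⟩
  have hζ' : ‖ζ‖ < r := by simpa using hζ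
  change ‖eta ρ ζ‖ + ‖zvar ρ ζ‖ < 1
  rw [norm_eta_add_norm_zvar]
  refine lt_of_le_of_lt ?_ hr
  gcongr

theorem analyticOnNhd_LFR {ρ α h : ℝ}
    (hh : ∀ m : ℕ, 2 ≤ m → h ≠ 4 * (1 + ρ ^ 2) * (m : ℝ) ^ 2) :
    AnalyticOnNhd ℂ (LFR ρ α h) (domain ρ) := by
  intro ξ hξ
  obtain ⟨r, hr, hξr, hsub⟩ := exists_ball_subset_domain hξ
  have := (hasFPowerSeriesOnBall_of_hasSum hr
    fun ζ hζ => hasSum_lameSeries (α := α) hh (hsub hζ)).analyticOnNhd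
  rw [Metric.eball_ofReal] at this
  exact this ξ hξr

theorem LFR_zero {ρ α h : ℝ}
    (hh : ∀ m : ℕ, 2 ≤ m → h ≠ 4 * (1 + ρ ^ 2) * (m : ℝ) ^ 2) :
    LFR ρ α h 0 = 1 := by
  have h1 := hasSum_lameSeries (α := α) hh (zero_mem_domain ρ)
  have h2 : HasSum (fun n => lameSeries ρ α h n * (0 : ℂ) ^ n) (lameSeries ρ α h 0 * 0 ^ 0) :=
    hasSum_single 0 fun n hn => by simp [hn]
  rw [h1.unique h2, lameSeries_zero, pow_zero, mul_one]

theorem lameOp_LFR {ρ α h : ℝ}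
    (hh : ∀ m : ℕ, 2 ≤ m → h ≠ 4 * (1 + ρ ^ 2) * (m : ℝ) ^ 2) {ξ : ℂ}
    (hξ : ξ ∈ domain ρ) : lameOp ρ α h (LFR ρ α h) ξ = 0 := by
  obtain ⟨r, hr, hξr, hsub⟩ := exists_ball_subset_domain hξ
  have := hasSum_lameOp ρ α h hr (fun ζ hζ => hasSum_lameSeries (α := α) hh (hsub hζ)) ξ hξr
  simp only [opCoeff_lameSeries, zero_mul] at this
  exact this.unique hasSum_zero

lemma ne_singular_of_mem_domain {ρ : ℝ} (hρ0 : 0 < ρ) (hρ1 : ρ < 1) {ξ : ℂ} (hξ : ξ ∈ domain ρ) :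
    ξ ≠ 1 ∧ (ρ : ℂ) ^ 2 * ξ ≠ 1 := by
  have hn := norm_lt_one_of_mem_domain hξ
  constructor
  · rintro rfl
    simp at hn
  · intro he
    have := congrArg norm he
    rw [norm_mul, norm_pow, Complex.norm_real, norm_one, Real.norm_eq_abs, sq_abs] at this
    nlinarith [norm_nonneg ξ]

theorem eventuallyEq_LFR {ρ α h : ℝ}
    (hh : ∀ m : ℕ, 2 ≤ m → h ≠ 4 * (1 + ρ ^ 2) * (m : ℝ) ^ 2)
    (hρ0 : 0 < ρ) (hρ1 : ρ < 1) {y : ℂ → ℂ} (hy : AnalyticAt ℂ y 0)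
    (hy0 : y 0 = 1) (heq : ∀ᶠ ξ in 𝓝[≠] (0 : ℂ), LameEqAt ρ α h y ξ) :
    y =ᶠ[𝓝 0] LFR ρ α h := by
  obtain ⟨p, R, hp⟩ := hy
  obtain ⟨r, hr, hrR⟩ : ∃ r : ℝ, 0 < r ∧ ENNReal.ofReal r ≤ R := by
    obtain ⟨s, hs0, hs⟩ := ENNReal.lt_iff_exists_nnreal_btwn.1 hp.r_pos
    exact ⟨s, by simpa using hs0, by simpa using hs.le⟩
  have hsum : ∀ ξ ∈ Metric.ball (0 : ℂ) r, HasSum (fun n => p.coeff n * ξ ^ n) (y ξ) := by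
    intro ξ hξ
    have := hp.hasSum (y := ξ) (by
      rw [← Metric.eball_ofReal] at hξ
      exact Metric.eball_subset_eball hrR hξ)
    simpa [FormalMultilinearSeries.apply_eq_pow_smul_coeff, mul_comm] using this
  have hop := (hasFPowerSeriesOnBall_of_hasSum hr (hasSum_lameOp ρ α h hr hsum)).hasFPowerSeriesAt
  have hdom : ∀ᶠ ξ in 𝓝[≠] (0 : ℂ), ξ ∈ domain ρ :=
    nhdsWithin_le_nhds ((isOpen_domain ρ).mem_nhds (zero_mem_domain ρ))
  have hzero : ∀ᶠ ξ in 𝓝[≠] (0 : ℂ), lameOp ρ α h y ξ = 0 := by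
    filter_upwards [heq, hdom, self_mem_nhdsWithin] with ξ h1 h2 h3
    obtain ⟨h4, h5⟩ := ne_singular_of_mem_domain hρ0 hρ1 h2
    exact (lameEqAt_iff hρ0.ne' h3 h4 h5).1 h1
  -- `lameOp` applied to `y` is analytic at `0` and vanishes on a punctured neighbourhood, hence
  -- near `0`; so all its coefficients vanish and the recurrence fixes those of `y`.
  have hz := hop.analyticAt.frequently_zero_iff_eventually_zero.1 hzero.frequently
  have hp0 := (hop.congr hz).eq_zero
  have hc : opCoeff ρ α h p.coeff = 0 := 
    (FormalMultilinearSeries.ofScalars_series_eq_zero ℂ).1 hp0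
  have h0 : p.coeff 0 = 1 := by
    rw [← hy0]
    have h1 := hsum 0 (by simpa using hr)
    have h2 : HasSum (fun n => p.coeff n * (0 : ℂ) ^ n) (p.coeff 0 * 0 ^ 0) :=
      hasSum_single 0 fun n hn => by simp [hn]
    rw [h1.unique h2, pow_zero, mul_one]
  have hcoeff := eq_lameSeries_of_opCoeff_eq_zero h0 fun n => congrFun hc n
  filter_upwards [Metric.ball_mem_nhds (0 : ℂ) hr,
    (isOpen_domain ρ).mem_nhds (zero_mem_domain ρ)] with ξ h1 h2
  have h3 := hsum ξ h1
  simp only [hcoeff] at h3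
  exact h3.unique (hasSum_lameSeries hh h2)


/-! ### Jacobi's `sn` and Weierstrass's form. -/

/-- The polynomial `(1 - s²) (1 - ρ² s²)`, the square of `sn'` as a function of `s = sn`. -/
def snQuartic (ρ s : ℝ) : ℝ := (1 - s ^ 2) * (1 - ρ ^ 2 * s ^ 2)

section Sn

variable {ρ : ℝ}

lemma snQuartic_pos (hρ0 : 0 < ρ) (hρ1 : ρ < 1) {s : ℝ} (hs : s ∈ Set.Ioo (-1 : ℝ) 1) :
    0 < snQuartic ρ s := by
  have h1 : s ^ 2 < 1 := by nlinarith [hs.1, hs.2]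
  have h2 : ρ ^ 2 < 1 := by nlinarith
  have h3 : ρ ^ 2 * s ^ 2 < 1 := by nlinarith [sq_nonneg s]
  exact mul_pos (by linarith) (by linarith)

lemma hasDerivAt_snQuartic (ρ s : ℝ) :
    HasDerivAt (snQuartic ρ) (2 * (-(1 + ρ ^ 2) * s + 2 * ρ ^ 2 * s ^ 3)) s := by
  have h := (((hasDerivAt_pow 2 s).const_sub 1).mul
    (((hasDerivAt_pow 2 s).const_mul (ρ ^ 2)).const_sub 1))
  refine h.congr_deriv ?_
  push_cast
  ring

lemma hasStrictDerivAt_ellipticF (hρ0 : 0 < ρ) (hρ1 : ρ < 1) {x : ℝ}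
    (hx : x ∈ Set.Ioo (-1 : ℝ) 1) :
    HasStrictDerivAt (ellipticF ρ) (1 / √(snQuartic ρ x)) x := by
  have hcont : ContinuousOn (fun t : ℝ => 1 / √((1 - t ^ 2) * (1 - ρ ^ 2 * t ^ 2)))
      (Set.Ioo (-1 : ℝ) 1) := by
    refine continuousOn_const.div (by fun_prop) fun t ht => ?_
    exact (Real.sqrt_pos.2 (snQuartic_pos hρ0 hρ1 ht)).ne'
  have hsub : Set.uIcc 0 x ⊆ Set.Ioo (-1 : ℝ) 1 :=
    Set.OrdConnected.uIcc_subset Set.ordConnected_Ioo (by norm_num) hx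
  exact intervalIntegral.integral_hasStrictDerivAt_right
    (hcont.mono hsub).intervalIntegrable
    (hcont.stronglyMeasurableAtFilter isOpen_Ioo x hx)
    (hcont.continuousAt (isOpen_Ioo.mem_nhds hx))

lemma injOn_ellipticF (hρ0 : 0 < ρ) (hρ1 : ρ < 1) :
    Set.InjOn (ellipticF ρ) (Set.Ioo (-1) 1) := by
  refine (strictMonoOn_of_deriv_pos (convex_Ioo (-1 : ℝ) 1) (fun x hx =>
    (hasStrictDerivAt_ellipticF hρ0 hρ1 hx).hasDerivAt.continuousAt.continuousWithinAt)
    fun x hx => ?_).injOn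
  rw [interior_Ioo] at hx
  rw [(hasStrictDerivAt_ellipticF hρ0 hρ1 hx).hasDerivAt.deriv]
  exact one_div_pos.2 (Real.sqrt_pos.2 (snQuartic_pos hρ0 hρ1 hx))

lemma sn_mem {u : ℝ} (hu : u ∈ snDomain ρ) : sn ρ u ∈ Set.Ioo (-1 : ℝ) 1 :=
  Function.invFunOn_mem hu

lemma ellipticF_sn {u : ℝ} (hu : u ∈ snDomain ρ) : ellipticF ρ (sn ρ u) = u :=
  Function.invFunOn_eq hu

lemma map_nhds_ellipticF (hρ0 : 0 < ρ) (hρ1 : ρ < 1) {x : ℝ} (hx : x ∈ Set.Ioo (-1 : ℝ) 1) :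
    map (ellipticF ρ) (𝓝 x) = 𝓝 (ellipticF ρ x) :=
  (hasStrictDerivAt_ellipticF hρ0 hρ1 hx).map_nhds_eq
    (one_div_pos.2 (Real.sqrt_pos.2 (snQuartic_pos hρ0 hρ1 hx))).ne'

lemma isOpen_snDomain (hρ0 : 0 < ρ) (hρ1 : ρ < 1) : IsOpen (snDomain ρ) := by
  rw [isOpen_iff_mem_nhds]
  rintro _ ⟨x, hx, rfl⟩
  rw [← map_nhds_ellipticF hρ0 hρ1 hx]
  exact image_mem_map (isOpen_Ioo.mem_nhds hx)

/-- `ellipticF` maps neighbourhoods onto neighbourhoods by its nonzero strict derivative, so its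
left inverse is continuous; this is what the inverse rule for derivatives requires. -/
lemma continuousAt_sn (hρ0 : 0 < ρ) (hρ1 : ρ < 1) {u : ℝ} (hu : u ∈ snDomain ρ) :
    ContinuousAt (sn ρ) u := by
  have hx := sn_mem hu
  have hleft : ∀ y ∈ Set.Ioo (-1 : ℝ) 1, sn ρ (ellipticF ρ y) = y := fun y hy =>
    (injOn_ellipticF hρ0 hρ1).leftInvOn_invFunOn hy
  have : Tendsto (sn ρ) (𝓝 (ellipticF ρ (sn ρ u))) (𝓝 (sn ρ u)) := by
    rw [← map_nhds_ellipticF hρ0 hρ1 hx, tendsto_map'_iff]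
    refine tendsto_id.congr' ?_
    filter_upwards [isOpen_Ioo.mem_nhds hx] with y hy
    exact (hleft y hy).symm
  rwa [ellipticF_sn hu] at this

lemma hasDerivAt_sn (hρ0 : 0 < ρ) (hρ1 : ρ < 1) {u : ℝ} (hu : u ∈ snDomain ρ) :
    HasDerivAt (sn ρ) (√(snQuartic ρ (sn ρ u))) u := by
  have hx := sn_mem hu
  have := HasDerivAt.of_local_left_inverse (continuousAt_sn hρ0 hρ1 hu)
    (hasStrictDerivAt_ellipticF hρ0 hρ1 hx).hasDerivAt
    (one_div_pos.2 (Real.sqrt_pos.2 (snQuartic_pos hρ0 hρ1 hx))).ne'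
    (by filter_upwards [(isOpen_snDomain hρ0 hρ1).mem_nhds hu] with v hv using ellipticF_sn hv)
  simpa using this

/-- The root in `sn'` cancels the one from differentiating `√`, so `sn''` is half the derivative of
the quartic at `sn`. -/
lemma hasDerivAt_sqrt_snQuartic_sn (hρ0 : 0 < ρ) (hρ1 : ρ < 1) {u : ℝ} (hu : u ∈ snDomain ρ) :
    HasDerivAt (fun v => √(snQuartic ρ (sn ρ v)))
      (-(1 + ρ ^ 2) * sn ρ u + 2 * ρ ^ 2 * sn ρ u ^ 3) u := by
  have hpos := snQuartic_pos hρ0 hρ1 (sn_mem hu)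
  have h := ((hasDerivAt_snQuartic ρ (sn ρ u)).comp u (hasDerivAt_sn hρ0 hρ1 hu)).sqrt hpos.ne'
  refine h.congr_deriv ?_
  have := (Real.sqrt_pos.2 hpos).ne'
  simp only [Function.comp]
  field_simp

/-- Bootstrap: `sn' = √(snQuartic ρ sn)` is as smooth as `sn`, the quartic being positive. -/
lemma contDiffOn_sn_succ (hρ0 : 0 < ρ) (hρ1 : ρ < 1) {n : ℕ}
    (hn : ContDiffOn ℝ n (sn ρ) (snDomain ρ)) :
    ContDiffOn ℝ (n + 1 : ℕ) (sn ρ) (snDomain ρ) := by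
  push_cast
  rw [contDiffOn_succ_iff_deriv_of_isOpen (isOpen_snDomain hρ0 hρ1)]
  refine ⟨fun u hu => (hasDerivAt_sn hρ0 hρ1 hu).differentiableAt.differentiableWithinAt,
    by simp, ?_⟩
  have : ContDiffOn ℝ n (fun v => √(snQuartic ρ (sn ρ v))) (snDomain ρ) := by
    refine ContDiffOn.sqrt ?_ fun u hu => (snQuartic_pos hρ0 hρ1 (sn_mem hu)).ne'
    unfold snQuartic
    fun_prop
  exact this.congr fun u hu => (hasDerivAt_sn hρ0 hρ1 hu).deriv

lemma contDiffOn_sn (hρ0 : 0 < ρ) (hρ1 : ρ < 1) (n : ℕ) :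
    ContDiffOn ℝ n (sn ρ) (snDomain ρ) := by
  induction n with
  | zero =>
    exact contDiffOn_zero.2 fun u hu => (continuousAt_sn hρ0 hρ1 hu).continuousWithinAt
  | succ n ih => exact contDiffOn_sn_succ hρ0 hρ1 ih

end Sn

theorem weierstrass_form {ρ α h : ℝ}
    (hh : ∀ m : ℕ, 2 ≤ m → h ≠ 4 * (1 + ρ ^ 2) * (m : ℝ) ^ 2) (hρ0 : 0 < ρ) (hρ1 : ρ < 1) {u : ℝ}
    (hu : u ∈ snDomain ρ) (hD : (sn ρ u : ℂ) ^ 2 ∈ domain ρ) :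
    ContDiffAt ℝ 2 (fun v : ℝ => LFR ρ α h ((sn ρ v : ℂ) ^ 2)) u ∧
      deriv (deriv fun v : ℝ => LFR ρ α h ((sn ρ v : ℂ) ^ 2)) u =
        ((α * (α + 1) * ρ ^ 2 * sn ρ u ^ 2 - h : ℝ) : ℂ) * LFR ρ α h ((sn ρ u : ℂ) ^ 2) := by
  have hopen := isOpen_snDomain hρ0 hρ1
  have hF := analyticOnNhd_LFR (α := α) hh
  have hsq : ∀ v ∈ snDomain ρ, HasDerivAt (fun v : ℝ => (sn ρ v : ℂ) ^ 2)
      (2 * sn ρ v * √(snQuartic ρ (sn ρ v)) : ℂ) v := fun v hv => by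
    have := (hasDerivAt_sn hρ0 hρ1 hv).ofReal_comp.pow 2
    refine this.congr_deriv ?_
    push_cast
    ring
  constructor
  · have h1 : ContDiffAt ℝ 2 (sn ρ) u :=
      (contDiffOn_sn hρ0 hρ1 2).contDiffAt (hopen.mem_nhds hu)
    have h2 : ContDiffAt ℝ 2 (fun v : ℝ => (sn ρ v : ℂ) ^ 2) u :=
      (Complex.ofRealCLM.contDiff.contDiffAt.comp u h1).pow 2
    have h3 : ContDiffAt ℝ 2 (LFR ρ α h) ((sn ρ u : ℂ) ^ 2) :=
      (hF _ hD).contDiffAt.restrict_scalars ℝ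
    exact h3.comp u h2
  · have hfirst : ∀ v ∈ snDomain ρ, (sn ρ v : ℂ) ^ 2 ∈ domain ρ →
        HasDerivAt (fun v : ℝ => LFR ρ α h ((sn ρ v : ℂ) ^ 2))
          (deriv (LFR ρ α h) ((sn ρ v : ℂ) ^ 2) *
            (2 * sn ρ v * √(snQuartic ρ (sn ρ v)) : ℂ)) v := fun v hv hvD => by
      have hd := (hF _ hvD).differentiableAt.hasDerivAt
      exact hd.comp v (hsq v hv)
    have hev : (deriv fun v : ℝ => LFR ρ α h ((sn ρ v : ℂ) ^ 2)) =ᶠ[𝓝 u] fun v =>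
        deriv (LFR ρ α h) ((sn ρ v : ℂ) ^ 2) * (2 * sn ρ v * √(snQuartic ρ (sn ρ v)) : ℂ) := by
      filter_upwards [hopen.mem_nhds hu,
        (hsq u hu).continuousAt.preimage_mem_nhds ((isOpen_domain ρ).mem_nhds hD)] with v hv hvD
      exact (hfirst v hv hvD).deriv
    rw [hev.deriv_eq]
    have hd1 := (hF _ hD).deriv.differentiableAt.hasDerivAt.comp u (hsq u hu)
    have hd2 := (((hasDerivAt_sn hρ0 hρ1 hu).ofReal_comp).const_mul 2).mul
      (hasDerivAt_sqrt_snQuartic_sn hρ0 hρ1 hu).ofReal_comp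
    have hd := hd1.mul hd2
    refine (HasDerivAt.deriv hd).trans ?_
    have hop := lameOp_LFR (α := α) hh hD
    have hroot : ((√(snQuartic ρ (sn ρ u)) : ℝ) : ℂ) ^ 2 =
        (1 - (sn ρ u : ℂ) ^ 2) * (1 - (ρ : ℂ) ^ 2 * (sn ρ u : ℂ) ^ 2) := by
      rw [← Complex.ofReal_pow, Real.sq_sqrt (snQuartic_pos hρ0 hρ1 (sn_mem hu)).le, snQuartic]
      push_cast
      rfl
    rw [lameOp] at hop
    simp only [Function.comp, Pi.mul_apply]
    push_cast
    -- For `ξ = s²` with `s = sn`, `ξ'² = 4 s² s'²` accounts for the factor `4`. The multiples of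
    -- `hroot` replace `s'²` in the terms with `F''` and `F'`, where `F` is `LFR ρ α h`.
    linear_combination 4 * hop + (4 * (sn ρ u : ℂ) ^ 2 *
      deriv (deriv (LFR ρ α h)) ((sn ρ u : ℂ) ^ 2) +
      2 * deriv (LFR ρ α h) ((sn ρ u : ℂ) ^ 2)) * hroot

end Lame

end

theorem mainTheorem3 (ρ α h : ℝ) (hρ0 : 0 < ρ) (hρ1 : ρ < 1)
    (hh : ∀ m : ℕ, 2 ≤ m → h ≠ 4 * (1 + ρ ^ 2) * (m : ℝ) ^ 2) :
    -- every series in the R3TRF expansion converges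
    (∀ ξ ∈ Lame.domain ρ, Lame.NestedConverges (Lame.rWeight ρ h) (Lame.rFactor α)
        (Lame.eta ρ ξ) (Lame.zvar ρ ξ)) ∧
    -- its sum is the Frobenius solution with exponent `0` and `c₀ = 1`
    AnalyticOnNhd ℂ (Lame.LFR ρ α h) (Lame.domain ρ) ∧
    Lame.LFR ρ α h 0 = 1 ∧
    (∀ ξ ∈ Lame.domain ρ, ξ ≠ 0 → Lame.LameEqAt ρ α h (Lame.LFR ρ α h) ξ) ∧
    (∀ y : ℂ → ℂ, AnalyticAt ℂ y 0 → y 0 = 1 →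
      (∀ᶠ ξ in nhdsWithin (0 : ℂ) {0}ᶜ, Lame.LameEqAt ρ α h y ξ) →
      y =ᶠ[nhds 0] Lame.LFR ρ α h) ∧
    -- with `ξ = sn²(u, ρ)` it solves Lamé's equation in Weierstrass's form
    (∀ u ∈ Lame.snDomain ρ, ((Lame.sn ρ u : ℂ)) ^ 2 ∈ Lame.domain ρ →
      ContDiffAt ℝ 2 (fun v : ℝ => Lame.LFR ρ α h ((Lame.sn ρ v : ℂ) ^ 2)) u ∧
      deriv (deriv fun v : ℝ => Lame.LFR ρ α h ((Lame.sn ρ v : ℂ) ^ 2)) u =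
        ((α * (α + 1) * ρ ^ 2 * Lame.sn ρ u ^ 2 - h : ℝ) : ℂ)
          * Lame.LFR ρ α h ((Lame.sn ρ u : ℂ) ^ 2)) ∧
    -- it is equivalent to the 3TRF series, whenever the latter is an infinite series
    ((∀ m : ℕ, 1 ≤ m → α ≠ 2 * (m : ℝ) ∧ α ≠ -(2 * (m : ℝ) + 1)) →
      ∀ ξ ∈ Lame.domain ρ,
        Lame.NestedConverges (Lame.tWeight α) (Lame.tFactor ρ h)
          (Lame.zvar ρ ξ) (Lame.eta ρ ξ) ∧
        Lame.LFR ρ α h ξ = Lame.LF ρ α h ξ) := by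
  refine ⟨fun ξ hξ => (Lame.nestedConverges_rWeight hh hξ).1, Lame.analyticOnNhd_LFR hh,
    Lame.LFR_zero hh, fun ξ hξ h0 => ?_,
    fun y hy hy0 heq => Lame.eventuallyEq_LFR hh hρ0 hρ1 hy hy0 heq,
    fun u hu hD => Lame.weierstrass_form hh hρ0 hρ1 hu hD, fun hα ξ hξ => ?_⟩
  · obtain ⟨h1, h2⟩ := Lame.ne_singular_of_mem_domain hρ0 hρ1 hξ
    exact (Lame.lameEqAt_iff hρ0.ne' h0 h1 h2).2 (Lame.lameOp_LFR hh hξ)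
  · obtain ⟨h1, h2⟩ := Lame.nestedConverges_tWeight (ρ := ρ) (h := h) hα hξ
    exact ⟨h1, (Lame.nestedConverges_rWeight hh hξ).2.trans h2.symm⟩
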